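/- **Setting.** Fix a path-loss exponent $\alpha>0$ and an SINR threshold $\beta>0$. An instance consists of $n\ge 2$ links $\ell_v=(s_v,r_v)$ (sender $s_v$, receiver $r_v\neq s_v$) in a metric space $(X,d)$, $k\ge 1$ channels, an ambient noise level $\nu\ge 0$, and valuations $b_{v,T}\in\mathbb N$ for all links $v$ and all $T\subseteq[k]$. Write $d_v=d(s_v,r_v)$. An allocation $S$ assigns to each link $v$ a bundle $S(v)\subseteq[k]$ and has social welfare $b(S)=\sum_v b_{v,S(v)}$. A set $M$ of links satisfies the SINR constraints at powers $p>0$ if $$\frac{p_i}{d(s_i,r_i)^\alpha}\ \ge\ \beta\Big(\sum_{j\in M\setminus\{i\}}\frac{p_j}{d(s_j,r_i)^\alpha}+\nu\Big)\qquad\text{for all } i\in M .$$ An allocation is feasible (with power control) if for every channel $j$ the set $\{v: j\in S(v)\}$ satisfies the SINR constraints at some positive powers, which may depend on $j$. **Weights.** Let $\pi$ be an ordering of the links by decreasing length $d_v$ (ties broken arbitrarily). For a parameter $\tau>0$ let $$w(u,v)=\frac1\tau\min\Big\{1,\frac{d_u^\alpha}{d(s_u,r_v)^\alpha}\Big\}+\frac1\tau\min\Big\{1,\frac{d_u^\alpha}{d(s_v,r_u)^\alpha}\Big\}\quad\text{if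 }\pi(v)<\pi(u)$$ (so $u$ is the shorter link), $w(u,v)=0$ otherwise, and $\bar w(u,v)=w(u,v)+w(v,u)$. A ratio with denominator $0$ counts as $\infty$. **Algorithm**, with parameters $\tau,\rho>0$. 1. Take an optimal solution $x$ of the LP that maximizes $\sum_{v,T}b_{v,T}x_{v,T}$ subject to $\sum_{u:\pi(u)<\pi(v)}\sum_{T\ni j}\bar w(u,v)x_{u,T}\le\rho$ for all $v,j$, and $\sum_T x_{v,T}\le 1$, $x_{v,T}\ge 0$ for all $v,T$. 2. Split $x=x^{(1)}+x^{(2)}$, where $x^{(1)}$ is the part of $x$ on bundles of size at most $\sqrt k$. For $l=1,2$, independently for all $v$, set $S^{(l)}(v):=T$ with probability $x^{(l)}_{v,T}/(4\sqrt k\rho)$ for each $T\ne\emptyset$, and $S^{(l)}(v):=\emptyset$ with the remaining probability. Then, for the links $v$ in the order $\pi$, set $S^{(l)}(v):=\emptyset$ if $\sum\bar w(u,v)\ge\frac12$, where the sum is over all $u$ with $\pi(u)<\pi(v)$ and $S^{(l)}(u)\cap S^{(l)}(v)\neq\emptyset$. Let $S$ be the better of $S^{(1)},S^{(2)}$. 3.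 Let $V'$ be the set of all links. While $V'\ne\emptyset$, for $i=1,2,\dots$: let $S_i(v)=S(v)$ for $v\in V'$ and $S_i(v)=\emptyset$ otherwise; consider the links $v\in V'$ in order of decreasing $\pi$; if $\sum_{u:S_i(u)\cap S_i(v)\ne\emptyset}\bar w(u,v)<1$, then delete $v$ from $V'$ (and keep $S_i(v)$), otherwise set $S_i(v):=\emptyset$. Return the $S_i$ of largest welfare. 4. Power control: on each channel, consider the set $M$ of links assigned to it from long to short and set $$p_v=2\beta\, d_v^\alpha\Big(\nu'+\sum_{u\in M,\ \pi(u)<\pi(v)}\frac{p_u}{d(s_u,r_v)^\alpha}\Big),$$ with $\nu'=\nu$ if $\nu>0$ and $\nu'=1$ if $\nu=0$. For real $C,\delta$, say that $X$ has $(C,\delta)$-packing if every ball of radius $R$ contains at most $C(R/t)^\delta$ points of mutual distance at least $t$, for all $0<t\le R$. The metric is *fading* if this holds for some $C$ and some $\delta<\alpha$, i.e. if its doubling dimension is less than $\alpha$. **Theorem.** There is $\tau>0$, depending only on $\alpha,\beta$, such that the following hold. * *Fading metrics.* For all $C$ and all $\delta<\alpha$ there are $\rho>0$ and $K>0$, depending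 only on $\alpha,\beta,C,\delta$, such that on every instance in a metric space with $(C,\delta)$-packing the algorithm with parameters $\tau,\rho$ is a $K\sqrt k\,\log n$-approximation. * *General metrics.* There are $c>0$ and $K>0$, depending only on $\alpha,\beta$, such that on every instance in any metric space the algorithm with parameters $\tau$ and $\rho=c\log n$ is a $K\sqrt k\,\log^2 n$-approximation. Here "a $q$-approximation" means: the LP has an optimal solution and, whichever one is used, the numbers in step 2 are probabilities; for every outcome of the random choices, on every channel the links assigned to it by the returned allocation satisfy the SINR constraints at the powers computed in step 4; and $b(S^*)\le q\cdot\mathbb E[b(\text{returned allocation})]$ for every feasible allocation $S^*$. -/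

import Mathlib

namespace SpectrumAuction

noncomputable section

/-! ### Allocations and the physical model

There are `n` links, indexed by `Fin n`; link `v` has sender `s v` and receiver `r v` in a metric
space `X`. There are `k` channels, indexed by `Fin k`. -/

/-- An allocation gives every link a bundle of channels. -/
abbrev Alloc (n k : ℕ) : Type := Fin n → Finset (Fin k)

/-- Social welfare of an allocation. -/
def welfare {n k : ℕ} (b : Fin n → Finset (Fin k) → ℕ) (S : Alloc n k) : ℕ :=
  ∑ v, b v (S v)

/-- The links that are assigned channel `j`. -/
def channelSet {n k : ℕ} (S : Alloc n k) (j : Fin k) : Finset (Fin n) :=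
  Finset.univ.filter fun v => j ∈ S v

/-- The links in `M`, transmitting at (positive) powers `p` at the same time on the same channel,
all satisfy the SINR constraint with path-loss exponent `α`, threshold `β` and noise `ν`.
A foreign sender located at the receiver would cause infinite interference; since Lean has
`x / 0 = 0`, this case is excluded explicitly. -/
def SINR {X : Type*} [MetricSpace X] {n : ℕ} (α β ν : ℝ) (s r : Fin n → X)
    (M : Finset (Fin n)) (p : Fin n → ℝ) : Prop :=
  ∀ i ∈ M, 0 < p i ∧ (∀ j ∈ M.erase i, s j ≠ r i) ∧
    β * (∑ j ∈ M.erase i, p j / dist (s j) (r i) ^ α + ν) ≤ p i / dist (s i) (r i) ^ α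

/-- Feasibility with power control: on every channel the assigned links satisfy the SINR
constraints for some choice of powers (powers may differ between channels). -/
def PowerFeasible {X : Type*} [MetricSpace X] {n k : ℕ} (α β ν : ℝ) (s r : Fin n → X)
    (S : Alloc n k) : Prop :=
  ∀ j, ∃ p : Fin n → ℝ, SINR α β ν s r (channelSet S j) p

/-- `X` has the packing property with constant `C` and exponent `δ`: a ball of radius `R` contains
at most `C (R / t) ^ δ` points of mutual distance at least `t`. The doubling dimension of `X` is the
infimum of the exponents `δ` that admit some `C`, and `X` is a fading metric for the path-loss
exponent `α` if its doubling dimension is smaller than `α`, i.e. if some `δ < α` and some `C` have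
this property. -/
def HasPacking (X : Type*) [MetricSpace X] (C δ : ℝ) : Prop :=
  ∀ (x : X) (R t : ℝ), 0 < t → t ≤ R → ∀ P : Finset X,
    (∀ y ∈ P, dist y x ≤ R) → (∀ y ∈ P, ∀ z ∈ P, y ≠ z → t ≤ dist y z) →
      (P.card : ℝ) ≤ C * (R / t) ^ δ

/-! ### Edge weights -/

/-- `min {1, a ^ α / b ^ α}` for `a > 0`, `b ≥ 0`, where the quotient is infinite if `b = 0`. -/
def cappedRatio (α a b : ℝ) : ℝ :=
  if b = 0 then 1 else min 1 (a ^ α / b ^ α)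

/-- The edge weight `w(u, v)`. The ordering `π` is by decreasing length, so `π v < π u` means that
`u` is the shorter of the two links; its length is the numerator in both ratios. -/
def weight {X : Type*} [MetricSpace X] {n : ℕ} (α τ : ℝ) (s r : Fin n → X)
    (π : Fin n ≃ Fin n) (u v : Fin n) : ℝ :=
  if π v < π u then
    1 / τ * cappedRatio α (dist (s u) (r u)) (dist (s u) (r v)) +
      1 / τ * cappedRatio α (dist (s u) (r u)) (dist (s v) (r u))
  else 0

/-- Symmetrization `w(u, v) + w(v, u)` of edge weights. -/
def symmWeight {n : ℕ} (w : Fin n → Fin n → ℝ) (u v : Fin n) : ℝ :=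
  w u v + w v u

/-! ### The linear program -/

/-- The constraints of the LP relaxation with parameter `ρ`, for symmetric weights `wb`. -/
def LPFeasible {n k : ℕ} (π : Fin n ≃ Fin n) (wb : Fin n → Fin n → ℝ) (ρ : ℝ)
    (x : Fin n → Finset (Fin k) → ℝ) : Prop :=
  (∀ v j, ∑ u ∈ Finset.univ.filter (fun u => π u < π v),
      ∑ T ∈ Finset.univ.filter (fun T : Finset (Fin k) => j ∈ T), wb u v * x u T ≤ ρ) ∧
  (∀ v, ∑ T, x v T ≤ 1) ∧
  (∀ v T, 0 ≤ x v T)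

/-- The objective of the LP. -/
def lpValue {n k : ℕ} (b : Fin n → Finset (Fin k) → ℕ) (x : Fin n → Finset (Fin k) → ℝ) : ℝ :=
  ∑ v, ∑ T, (b v T : ℝ) * x v T

/-- `x` is an optimal solution of the LP. -/
def LPOptimal {n k : ℕ} (π : Fin n ≃ Fin n) (wb : Fin n → Fin n → ℝ) (ρ : ℝ)
    (b : Fin n → Finset (Fin k) → ℕ) (x : Fin n → Finset (Fin k) → ℝ) : Prop :=
  LPFeasible π wb ρ x ∧ ∀ y, LPFeasible π wb ρ y → lpValue b y ≤ lpValue b x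

/-! ### Randomized rounding -/

/-- The part of the LP solution supported on bundles of size at most `√k`. -/
def smallPart {n k : ℕ} (x : Fin n → Finset (Fin k) → ℝ) : Fin n → Finset (Fin k) → ℝ :=
  fun v T => if (T.card : ℝ) ≤ Real.sqrt k then x v T else 0

/-- The remaining part of the LP solution. -/
def largePart {n k : ℕ} (x : Fin n → Finset (Fin k) → ℝ) : Fin n → Finset (Fin k) → ℝ :=
  fun v T => x v T - smallPart x v T

/-- Probability with which link `v` tentatively receives the bundle `T`: for `T ≠ ∅` it is
`x v T / (4 √k ρ)`, and the empty bundle takes the remaining probability. -/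
def roundProb {n k : ℕ} (ρ : ℝ) (x : Fin n → Finset (Fin k) → ℝ) (v : Fin n)
    (T : Finset (Fin k)) : ℝ :=
  if T = ∅ then
    1 - ∑ T' ∈ Finset.univ.erase (∅ : Finset (Fin k)), x v T' / (4 * Real.sqrt k * ρ)
  else x v T / (4 * Real.sqrt k * ρ)

/-- Probability of the tentative allocation `S`; the links are rounded independently. -/
def roundingProb {n k : ℕ} (ρ : ℝ) (x : Fin n → Finset (Fin k) → ℝ) (S : Alloc n k) : ℝ :=
  ∏ v, roundProb ρ x v (S v)

/-- Partial conflict resolution, considering the links in the order `π`: a link is removed if the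
total weight to earlier links that share a channel with it is at least `1 / 2`. -/
def partialResolve {n k : ℕ} (π : Fin n ≃ Fin n) (wb : Fin n → Fin n → ℝ) (S₀ : Alloc n k) :
    Alloc n k :=
  ((List.finRange n).map π.symm).foldl
    (fun S v =>
      if 1 / 2 ≤ ∑ u ∈ Finset.univ.filter (fun u => π u < π v ∧ (S v ∩ S u).Nonempty), wb u v
      then Function.update S v ∅ else S)
    S₀

/-- The better of two allocations. -/
def better {n k : ℕ} (b : Fin n → Finset (Fin k) → ℕ) (S₁ S₂ : Alloc n k) : Alloc n k :=
  if welfare b S₂ ≤ welfare b S₁ then S₁ else S₂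

/-! ### Making a partly feasible allocation feasible -/

/-- One round: start with the bundles of the links in `V'`, and consider these links in the order of
decreasing `π`. A link whose total weight to the links that currently share a channel with it is
less than `1` stays and is deleted from `V'`; any other link is removed from the allocation.
The result is the candidate allocation together with the set of links not deleted from `V'`. -/
def resolveRound {n k : ℕ} (π : Fin n ≃ Fin n) (wb : Fin n → Fin n → ℝ) (S : Alloc n k)
    (V' : Finset (Fin n)) : Alloc n k × Finset (Fin n) :=
  (((List.finRange n).reverse.map π.symm).filter (fun v => v ∈ V')).foldl
    (fun st v =>
      if ∑ u ∈ Finset.univ.filter (fun u => (st.1 v ∩ st.1 u).Nonempty), wb u v < 1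
      then (st.1, st.2.erase v)
      else (Function.update st.1 v ∅, st.2))
    ((fun v => if v ∈ V' then S v else ∅), V')

/-- The candidate allocations of the successive rounds, until `V'` is empty. The first argument
bounds the number of rounds; on a partly feasible allocation each round deletes at least one link
from `V'`, so a bound of `n` is never exceeded. -/
def candidates {n k : ℕ} (π : Fin n ≃ Fin n) (wb : Fin n → Fin n → ℝ) (S : Alloc n k) :
    ℕ → Finset (Fin n) → List (Alloc n k)
  | 0, _ => []
  | m + 1, V' =>
    if V' = ∅ then []
    else (resolveRound π wb S V').1 :: candidates π wb S m (resolveRound π wb S V').2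

/-- The best candidate allocation (the default is only used if there are no links). -/
def makeFeasible {n k : ℕ} (π : Fin n ≃ Fin n) (wb : Fin n → Fin n → ℝ)
    (b : Fin n → Finset (Fin k) → ℕ) (S : Alloc n k) : Alloc n k :=
  ((candidates π wb S n Finset.univ).argmax (welfare b)).getD S

/-- The allocation returned by the algorithm if the two rounding stages (for the small and for the
large bundles) produced the tentative allocations `S₁` and `S₂`. -/
def output {n k : ℕ} (π : Fin n ≃ Fin n) (wb : Fin n → Fin n → ℝ)
    (b : Fin n → Finset (Fin k) → ℕ) (S₁ S₂ : Alloc n k) : Alloc n k :=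
  makeFeasible π wb b (better b (partialResolve π wb S₁) (partialResolve π wb S₂))

/-- Expected welfare of the returned allocation, when the LP solution `x` is rounded. -/
def expectedWelfare {n k : ℕ} (π : Fin n ≃ Fin n) (wb : Fin n → Fin n → ℝ) (ρ : ℝ)
    (b : Fin n → Finset (Fin k) → ℕ) (x : Fin n → Finset (Fin k) → ℝ) : ℝ :=
  ∑ S₁ : Alloc n k, ∑ S₂ : Alloc n k,
    roundingProb ρ (smallPart x) S₁ * roundingProb ρ (largePart x) S₂ *
      (welfare b (output π wb b S₁ S₂) : ℝ)

/-! ### Power control -/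

/-- The power control procedure on a set `M` of links that share a channel. The links are considered
from long to short, and each one is given `2` times the power needed against the noise and the
interference of the longer links in `M`. (If there is no noise, powers can be scaled arbitrarily, and
the scale is fixed by calculating with noise level `1`.) -/
def powerControl {X : Type*} [MetricSpace X] {n : ℕ} (α β ν : ℝ) (s r : Fin n → X)
    (π : Fin n ≃ Fin n) (M : Finset (Fin n)) (v : Fin n) : ℝ :=
  2 * β * dist (s v) (r v) ^ α *
    ((∑ u ∈ (M.filter fun u => π u < π v).attach,
        powerControl α β ν s r π M u.1 / dist (s u.1) (r v) ^ α) +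
      if ν = 0 then 1 else ν)
termination_by π v
decreasing_by exact (Finset.mem_filter.mp u.2).2

theorem powerControl_eq {X : Type*} [MetricSpace X] {n : ℕ} (α β ν : ℝ) (s r : Fin n → X)
    (π : Fin n ≃ Fin n) (M : Finset (Fin n)) (v : Fin n) :
    powerControl α β ν s r π M v =
      2 * β * dist (s v) (r v) ^ α *
        ((∑ u ∈ M.filter fun u => π u < π v,
            powerControl α β ν s r π M u / dist (s u) (r v) ^ α) +
          if ν = 0 then 1 else ν) := by
  rw [powerControl, ← Finset.sum_attach (M.filter fun u => π u < π v)]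

/-! ### The performance guarantee -/

/-- LP rounding with parameter `ρ` and weights with parameter `τ`, in combination with power
control, works with approximation factor `ratio` on the given instance: the LP has an optimal
solution, and for each optimal solution
* the rounding stages draw from actual probability distributions,
* whatever they draw, the links sharing a channel in the returned allocation satisfy the SINR
  constraints at the powers computed by power control,
* the expected welfare is at least a `1 / ratio` fraction of the welfare of every allocation
  that is feasible for some choice of powers. -/
def Achieves {X : Type*} [MetricSpace X] {n k : ℕ} (α β ν τ ρ : ℝ) (s r : Fin n → X)
    (π : Fin n ≃ Fin n) (b : Fin n → Finset (Fin k) → ℕ) (ratio : ℝ) : Prop :=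
  (∃ x, LPOptimal π (symmWeight (weight α τ s r π)) ρ b x) ∧
  ∀ x, LPOptimal π (symmWeight (weight α τ s r π)) ρ b x →
    (∀ v T, 0 ≤ roundProb ρ (smallPart x) v T ∧ 0 ≤ roundProb ρ (largePart x) v T) ∧
    (∀ (S₁ S₂ : Alloc n k) (j : Fin k),
      SINR α β ν s r (channelSet (output π (symmWeight (weight α τ s r π)) b S₁ S₂) j)
        (powerControl α β ν s r π
          (channelSet (output π (symmWeight (weight α τ s r π)) b S₁ S₂) j))) ∧
    ∀ S : Alloc n k, PowerFeasible α β ν s r S →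
      (welfare b S : ℝ) ≤
        ratio * expectedWelfare π (symmWeight (weight α τ s r π)) ρ b x

end

end SpectrumAuction

namespace SpectrumAuction

/-! ### Capped ratios and edge weights -/

/-! The weights translate between geometry and the LP, and two facts about them carry the proof. If
all symmetrized weights at each link of a set sum to less than 1, the recursive powers work
(`powerControl_sinr`). Conversely, in a set that is feasible for any powers, the weight between a
link and the longer links of the set is at most `ρ`: bounded in fading metrics, `O(log n)` in
general. So the optimal allocation is an LP solution and the LP value bounds its welfare
(`welfare_le_of_lpOptimal`).

For power control, the recursion makes the signal at `v` twice what noise and longer links require,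
so the shorter links must not interfere by more than the longer ones and the noise together. Expand
the power of a shorter link `u` by the recursion: interference of `x` at `u` is passed on to `v`. By
the triangle inequality this is at most the direct interference of `x` at `v`, times `3 ^ α`, times
a sum of weight ratios. Those ratios sum to at most `τ` by the weight bounds at `v` and at `x`, and
for small `τ` the resulting self-referential inequality can be absorbed.

For the converse, feasibility allows only `O((R / t) ^ α)` links of length at least `t` with senders
(or receivers) in a ball of radius `R`. Summing the capped ratios over dyadic radii gives `O(1)` per
scale, over `O(log n)` scales. With packing exponent `δ < α` the counts improve to `O((R / t) ^ δ)`
and the scales form a geometric series.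

Rounding at scale `1 / (4 √k ρ)` keeps the expected weight to earlier conflicting links at most `1 /
4`, so by Markov's inequality half of the expected value survives partial resolution. This costs `8
√k ρ` for each of the two parts (`lpValue_smallPart_le`, `lpValue_largePart_le`). Full resolution
costs another `log₂ n + 1`, since by double counting each round finishes at least half of the
remaining links (`two_mul_card_resolveRound_le`). -/

theorem cappedRatio_nonneg {α a b : ℝ} (ha : 0 ≤ a) (hb : 0 ≤ b) : 0 ≤ cappedRatio α a b := by
  unfold cappedRatio
  split_ifs
  · exact zero_le_one
  · positivity

theorem cappedRatio_le_one (α a b : ℝ) : cappedRatio α a b ≤ 1 := by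
  unfold cappedRatio
  split_ifs
  · exact le_rfl
  · exact min_le_left _ _

theorem cappedRatio_eq_of_lt_one {α a b : ℝ} (h : cappedRatio α a b < 1) :
    b ≠ 0 ∧ cappedRatio α a b = a ^ α / b ^ α := by
  unfold cappedRatio at h ⊢
  split_ifs at h ⊢ with hb
  · exact absurd h (lt_irrefl _)
  · refine ⟨hb, min_eq_right ?_⟩
    by_contra! h'
    rw [min_eq_left h'.le] at h
    exact lt_irrefl _ h

theorem lt_of_cappedRatio_lt_one {α a b : ℝ} (hα : 0 < α) (hb : 0 ≤ b)
    (h : cappedRatio α a b < 1) : a < b := by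
  obtain ⟨hb0, he⟩ := cappedRatio_eq_of_lt_one h
  have hb' : 0 < b := lt_of_le_of_ne hb (Ne.symm hb0)
  by_contra! hab
  rw [he, div_lt_one (Real.rpow_pos_of_pos hb' α)] at h
  exact absurd (Real.rpow_le_rpow hb hab hα.le) (not_le.mpr h)

theorem cappedRatio_le_of_le {α a b c : ℝ} (hα : 0 < α) (ha : 0 < a) (hc : 0 < c)
    (h : c * a ≤ b) : cappedRatio α a b ≤ (c ^ α)⁻¹ := by
  have hb : 0 < b := lt_of_lt_of_le (by positivity) h
  unfold cappedRatio
  rw [if_neg hb.ne']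
  refine (min_le_right _ _).trans ?_
  rw [div_le_iff₀ (by positivity), ← div_eq_inv_mul, le_div_iff₀ (by positivity), mul_comm,
    ← Real.mul_rpow hc.le ha.le]
  exact Real.rpow_le_rpow (by positivity) h hα.le

section Metric

variable {X : Type*} [MetricSpace X] {n : ℕ}

theorem weight_nonneg {α τ : ℝ} (hτ : 0 < τ) (s r : Fin n → X) (π : Fin n ≃ Fin n)
    (u v : Fin n) : 0 ≤ weight α τ s r π u v := by
  unfold weight
  split_ifs
  · have h₁ := cappedRatio_nonneg (α := α) (dist_nonneg (x := s u) (y := r u))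
      (dist_nonneg (x := s u) (y := r v))
    have h₂ := cappedRatio_nonneg (α := α) (dist_nonneg (x := s u) (y := r u))
      (dist_nonneg (x := s v) (y := r u))
    positivity
  · exact le_rfl

theorem symmWeight_nonneg {w : Fin n → Fin n → ℝ} (hw : ∀ u v, 0 ≤ w u v) (u v : Fin n) :
    0 ≤ symmWeight w u v := add_nonneg (hw u v) (hw v u)

theorem symmWeight_comm (w : Fin n → Fin n → ℝ) (u v : Fin n) :
    symmWeight w u v = symmWeight w v u := add_comm _ _

theorem weight_self (α τ : ℝ) (s r : Fin n → X) (π : Fin n ≃ Fin n) (v : Fin n) :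
    weight α τ s r π v v = 0 := if_neg (lt_irrefl _)

theorem symmWeight_weight_of_lt {α τ : ℝ} {s r : Fin n → X} {π : Fin n ≃ Fin n} {u v : Fin n}
    (h : π v < π u) : symmWeight (weight α τ s r π) u v =
      1 / τ * (cappedRatio α (dist (s u) (r u)) (dist (s u) (r v)) +
        cappedRatio α (dist (s u) (r u)) (dist (s v) (r u))) := by
  unfold symmWeight weight
  rw [if_pos h, if_neg h.not_gt]
  ring

/-! ### Power control -/

theorem powerControl_pos {α β ν : ℝ} (hβ : 0 < β) (hν : 0 ≤ ν) {s r : Fin n → X}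
    (hsr : ∀ v, s v ≠ r v) (π : Fin n ≃ Fin n) (M : Finset (Fin n)) (v : Fin n) :
    0 < powerControl α β ν s r π M v := by
  have key : ∀ m : Fin n, ∀ v, π v = m → 0 < powerControl α β ν s r π M v := by
    intro m
    induction m using WellFoundedLT.induction with
    | ind m ih =>
      intro v hv
      rw [powerControl_eq]
      have hd : 0 < dist (s v) (r v) := dist_pos.mpr (hsr v)
      have hν' : 0 < (if ν = 0 then 1 else ν) := by
        split_ifs with h
        · exact zero_lt_one
        · exact lt_of_le_of_ne hν (Ne.symm h)
      have hsum : 0 ≤ ∑ u ∈ M.filter fun u => π u < π v,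
          powerControl α β ν s r π M u / dist (s u) (r v) ^ α := by
        refine Finset.sum_nonneg fun u hu => ?_
        have := ih (π u) (hv ▸ (Finset.mem_filter.mp hu).2) u rfl
        positivity
      positivity
  exact key _ v rfl

/-- Triangle inequality for path losses: interference that travels from a sender via a short link
to a receiver is dominated by direct interference. -/
theorem mul_inv_rpow_le {α A B D E : ℝ} (hα : 0 < α) (hA : 0 ≤ A) (hAB : A ≤ B) (hB : 0 < B)
    (hD : 0 < D) (hE : 0 < E) (h : D ≤ E + A + B) :
    A ^ α / B ^ α * (E ^ α)⁻¹ ≤ 3 ^ α * (D ^ α)⁻¹ * (A ^ α / B ^ α + A ^ α / E ^ α) := by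
  have hinv : ∀ F : ℝ, 0 < F → D ≤ 3 * F → (F ^ α)⁻¹ ≤ 3 ^ α * (D ^ α)⁻¹ := by
    intro F hF hDF
    rw [← div_eq_mul_inv, le_div_iff₀ (by positivity), inv_mul_le_iff₀ (by positivity), mul_comm,
      ← Real.mul_rpow (by norm_num) hF.le]
    exact Real.rpow_le_rpow hD.le hDF hα.le
  have hAα : 0 ≤ A ^ α := Real.rpow_nonneg hA α
  -- Since `A ≤ B`, the larger of `B` and `E` is at least `D / 3`. Its inverse power is traded for
  -- that of `D`, and the other one stays in the ratio.
  rcases le_total B E with hBE | hBE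
  · have h₁ := hinv E hE (by linarith)
    calc A ^ α / B ^ α * (E ^ α)⁻¹ ≤ A ^ α / B ^ α * (3 ^ α * (D ^ α)⁻¹) := by gcongr
      _ = 3 ^ α * (D ^ α)⁻¹ * (A ^ α / B ^ α + 0) := by ring
      _ ≤ _ := by gcongr; positivity
  · have h₁ := hinv B hB (by linarith)
    calc A ^ α / B ^ α * (E ^ α)⁻¹ = A ^ α / E ^ α * (B ^ α)⁻¹ := by
          simp only [div_eq_mul_inv]; ring
      _ ≤ A ^ α / E ^ α * (3 ^ α * (D ^ α)⁻¹) := by gcongr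
      _ = 3 ^ α * (D ^ α)⁻¹ * (0 + A ^ α / E ^ α) := by ring
      _ ≤ _ := by gcongr; positivity

theorem sum_cappedRatio_lt {α τ : ℝ} (hτ : 0 < τ) {s r : Fin n → X}
    {π : Fin n ≃ Fin n} {M : Finset (Fin n)} {v : Fin n}
    (hM : ∑ u ∈ M, symmWeight (weight α τ s r π) u v < 1) :
    ∑ u ∈ M.filter (fun u => π v < π u),
      (cappedRatio α (dist (s u) (r u)) (dist (s u) (r v)) +
        cappedRatio α (dist (s u) (r u)) (dist (s v) (r u))) < τ := by
  have h₁ : 1 / τ * ∑ u ∈ M.filter (fun u => π v < π u),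
      (cappedRatio α (dist (s u) (r u)) (dist (s u) (r v)) +
        cappedRatio α (dist (s u) (r u)) (dist (s v) (r u))) < 1 := by
    refine lt_of_le_of_lt ?_ hM
    rw [Finset.mul_sum]
    calc _ = ∑ u ∈ M.filter (fun u => π v < π u), symmWeight (weight α τ s r π) u v :=
          Finset.sum_congr rfl fun u hu =>
            (symmWeight_weight_of_lt (Finset.mem_filter.mp hu).2).symm
      _ ≤ _ := Finset.sum_le_sum_of_subset_of_nonneg (Finset.filter_subset _ _)
          fun u _ _ => symmWeight_nonneg (weight_nonneg hτ s r π) u v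
  rwa [one_div, inv_mul_lt_iff₀ hτ, mul_one] at h₁

/-- With `L` and `H` the interference from longer and shorter links, the signal at `v` is `2β(L +
ν')`, so everything reduces to `H ≤ L + ν'`. The smallness of `τ` makes the bound on `H` in terms of
`L`, `ν'` and `H` itself contractive. -/
theorem powerControl_sinr {α β ν τ : ℝ} (hα : 0 < α) (hβ : 0 < β) (hτ : 0 < τ) (hτ₁ : τ ≤ 1)
    (hτβ : 8 * β * 3 ^ α * (1 + 2 * β) * τ ≤ 1) (hν : 0 ≤ ν) {s r : Fin n → X}
    (hsr : ∀ v, s v ≠ r v) (π : Fin n ≃ Fin n) {M : Finset (Fin n)}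
    (hM : ∀ v ∈ M, ∑ u ∈ M, symmWeight (weight α τ s r π) u v < 1) :
    SINR α β ν s r M (powerControl α β ν s r π M) := by
  have hsum := fun v (hv : v ∈ M) => sum_cappedRatio_lt hτ (hM v hv)
  have hc₁ : ∀ u v, 0 ≤ cappedRatio α (dist (s u) (r u)) (dist (s u) (r v)) :=
    fun u v => cappedRatio_nonneg dist_nonneg dist_nonneg
  have hc₂ : ∀ u v, 0 ≤ cappedRatio α (dist (s u) (r u)) (dist (s v) (r u)) :=
    fun u v => cappedRatio_nonneg dist_nonneg dist_nonneg
  have hlt : ∀ v ∈ M, ∀ u ∈ M, π v < π u →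
      cappedRatio α (dist (s u) (r u)) (dist (s u) (r v)) +
        cappedRatio α (dist (s u) (r u)) (dist (s v) (r u)) < τ := by
    intro v hv u hu huv
    refine lt_of_le_of_lt ?_ (hsum v hv)
    exact Finset.single_le_sum
      (f := fun u => cappedRatio α (dist (s u) (r u)) (dist (s u) (r v)) +
        cappedRatio α (dist (s u) (r u)) (dist (s v) (r u)))
      (fun w _ => add_nonneg (hc₁ w v) (hc₂ w v)) (Finset.mem_filter.mpr ⟨hu, huv⟩)
  have hlt₁ : ∀ v ∈ M, ∀ u ∈ M, π v < π u →
      cappedRatio α (dist (s u) (r u)) (dist (s u) (r v)) < 1 := fun v hv u hu huv => by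
    linarith [hlt v hv u hu huv, hc₂ u v]
  have hlt₂ : ∀ v ∈ M, ∀ u ∈ M, π v < π u →
      cappedRatio α (dist (s u) (r u)) (dist (s v) (r u)) < 1 := fun v hv u hu huv => by
    linarith [hlt v hv u hu huv, hc₁ u v]
  -- A foreign sender located at a receiver would give a capped ratio of 1, hence a weight sum of at
  -- least `1 / τ ≥ 1`.
  have hne : ∀ v ∈ M, ∀ u ∈ M, s u ≠ r v := by
    intro v hv u hu
    rcases lt_trichotomy (π u) (π v) with h | h | h
    · exact dist_ne_zero.mp (cappedRatio_eq_of_lt_one (hlt₂ u hu v hv h)).1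
    · rw [π.injective h]
      exact hsr v
    · exact dist_ne_zero.mp (cappedRatio_eq_of_lt_one (hlt₁ v hv u hu h)).1
  have hsum₁ : ∀ v ∈ M, ∑ u ∈ M.filter (fun u => π v < π u),
      dist (s u) (r u) ^ α / dist (s u) (r v) ^ α ≤ τ := by
    intro v hv
    refine le_trans (Finset.sum_le_sum fun u hu => ?_) (hsum v hv).le
    rw [Finset.mem_filter] at hu
    rw [← (cappedRatio_eq_of_lt_one (hlt₁ v hv u hu.1 hu.2)).2]
    linarith [hc₂ u v]
  have hsum₂ : ∀ v ∈ M, ∑ u ∈ M.filter (fun u => π v < π u),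
      dist (s u) (r u) ^ α / dist (s v) (r u) ^ α ≤ τ := by
    intro v hv
    refine le_trans (Finset.sum_le_sum fun u hu => ?_) (hsum v hv).le
    rw [Finset.mem_filter] at hu
    rw [← (cappedRatio_eq_of_lt_one (hlt₂ v hv u hu.1 hu.2)).2]
    linarith [hc₁ u v]
  set p := powerControl α β ν s r π M with hp
  have hppos : ∀ v, 0 < p v := powerControl_pos hβ hν hsr π M
  set ν' : ℝ := if ν = 0 then 1 else ν with hν'
  have hν'ν : ν ≤ ν' := by
    rw [hν']
    split_ifs with h
    · rw [h]; exact zero_le_one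
    · exact le_rfl
  have hν'0 : 0 ≤ ν' := hν.trans hν'ν
  have hpeq : ∀ v, p v = 2 * β * dist (s v) (r v) ^ α *
      ((∑ u ∈ M.filter fun u => π u < π v, p u / dist (s u) (r v) ^ α) + ν') :=
    fun v => powerControl_eq α β ν s r π M v
  intro v hv
  refine ⟨hppos v, fun u hu => hne v hv u (Finset.mem_of_mem_erase hu), ?_⟩
  have hdv : 0 < dist (s v) (r v) ^ α := Real.rpow_pos_of_pos (dist_pos.mpr (hsr v)) α
  set L := ∑ u ∈ M.filter (fun u => π u < π v), p u / dist (s u) (r v) ^ α with hL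
  set H := ∑ u ∈ M.filter (fun u => π v < π u), p u / dist (s u) (r v) ^ α with hH
  have hL0 : 0 ≤ L := Finset.sum_nonneg fun u _ => by have := hppos u; positivity
  have hH0 : 0 ≤ H := Finset.sum_nonneg fun u _ => by have := hppos u; positivity
  have hsignal : p v / dist (s v) (r v) ^ α = 2 * β * (L + ν') := by
    rw [hpeq v, ← hL]
    field_simp
  have herase : ∑ u ∈ M.erase v, p u / dist (s u) (r v) ^ α = L + H := by
    have hdisj : Disjoint (M.filter fun u => π u < π v) (M.filter fun u => π v < π u) :=
      Finset.disjoint_filter.mpr fun u _ h => h.not_gt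
    rw [hL, hH, ← Finset.sum_union hdisj]
    refine Finset.sum_congr ?_ fun _ _ => rfl
    ext u
    have : u ≠ v ↔ π u < π v ∨ π v < π u := by
      rw [← π.injective.ne_iff]
      exact lt_or_lt_iff_ne.symm
    simp only [Finset.mem_erase, Finset.mem_union, Finset.mem_filter, this]
    tauto
  -- When a shorter link `u` is expanded, `v` itself is among the links longer than `u`, so its own
  -- signal enters the bound too.
  have htotal : ∑ x ∈ M, p x / dist (s x) (r v) ^ α = L + H + 2 * β * (L + ν') := by
    rw [← Finset.sum_erase_add M _ hv, herase, hsignal]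
  have hHle : H ≤ 2 * β * (ν' * τ + 2 * τ * 3 ^ α * (L + H + 2 * β * (L + ν'))) := by
    -- Unfold the recursion for `p u` and reroute each path from `x` via `u` to `v` with
    -- `mul_inv_rpow_le`. The condition that the length of `u` is at most its sender's distance to
    -- `r v` comes from the capped ratio being below 1.
    have hterm : ∀ u ∈ M.filter (fun u => π v < π u), p u / dist (s u) (r v) ^ α ≤
        2 * β * (ν' * (dist (s u) (r u) ^ α / dist (s u) (r v) ^ α) +
          ∑ x ∈ M.filter (fun x => π x < π u), 3 ^ α * (p x / dist (s x) (r v) ^ α) *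
            (dist (s u) (r u) ^ α / dist (s u) (r v) ^ α +
              dist (s u) (r u) ^ α / dist (s x) (r u) ^ α)) := by
      intro u hu
      obtain ⟨huM, huv⟩ := Finset.mem_filter.mp hu
      rw [hpeq u]
      calc _ = 2 * β * (ν' * (dist (s u) (r u) ^ α / dist (s u) (r v) ^ α) +
          ∑ x ∈ M.filter (fun x => π x < π u), p x * (dist (s u) (r u) ^ α /
            dist (s u) (r v) ^ α * (dist (s x) (r u) ^ α)⁻¹)) := by
            simp only [div_eq_mul_inv]
            rw [show ∑ x ∈ M.filter (fun x => π x < π u), p x * (dist (s u) (r u) ^ α *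
              (dist (s u) (r v) ^ α)⁻¹ * (dist (s x) (r u) ^ α)⁻¹) =
              dist (s u) (r u) ^ α * (dist (s u) (r v) ^ α)⁻¹ *
              ∑ x ∈ M.filter (fun x => π x < π u), p x * (dist (s x) (r u) ^ α)⁻¹ by
                rw [Finset.mul_sum]; exact Finset.sum_congr rfl fun _ _ => by ring]
            ring
        _ ≤ _ := by
            refine mul_le_mul_of_nonneg_left (add_le_add le_rfl
              (Finset.sum_le_sum fun x hx => ?_)) (by positivity)
            obtain ⟨hxM, hxu⟩ := Finset.mem_filter.mp hx
            have h := mul_inv_rpow_le hα (dist_nonneg (x := s u) (y := r u))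
              (lt_of_cappedRatio_lt_one hα dist_nonneg (hlt₁ v hv u huM huv)).le
              (dist_pos.mpr (hne v hv u huM)) (dist_pos.mpr (hne v hv x hxM))
              (dist_pos.mpr (hne u huM x hxM)) (by
                have h₁ := dist_triangle4 (s x) (r u) (s u) (r v)
                rwa [dist_comm (r u) (s u)] at h₁)
            refine (mul_le_mul_of_nonneg_left h (hppos x).le).trans (le_of_eq ?_)
            rw [div_eq_mul_inv (p x)]
            ring
    have hg : ∀ x, 0 ≤ 3 ^ α * (p x / dist (s x) (r v) ^ α) := fun x => by
      have := hppos x; positivity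
    refine (Finset.sum_le_sum hterm).trans ?_
    rw [← Finset.mul_sum, Finset.sum_add_distrib, ← Finset.mul_sum]
    refine mul_le_mul_of_nonneg_left (add_le_add
      (mul_le_mul_of_nonneg_left (hsum₁ v hv) hν'0) ?_) (by positivity)
    simp only [mul_add ((3 : ℝ) ^ α * (_ / _)), Finset.sum_add_distrib]
    -- The ratios towards `r v` do not depend on `x` and are summed by the weight bound at `v`.
    have hpart₁ : ∑ u ∈ M.filter (fun u => π v < π u), ∑ x ∈ M.filter (fun x => π x < π u),
        3 ^ α * (p x / dist (s x) (r v) ^ α) *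
          (dist (s u) (r u) ^ α / dist (s u) (r v) ^ α) ≤
        τ * 3 ^ α * ∑ x ∈ M, p x / dist (s x) (r v) ^ α := by
      calc _ ≤ ∑ u ∈ M.filter (fun u => π v < π u), ∑ x ∈ M,
            3 ^ α * (p x / dist (s x) (r v) ^ α) *
              (dist (s u) (r u) ^ α / dist (s u) (r v) ^ α) :=
            Finset.sum_le_sum fun u _ => Finset.sum_le_sum_of_subset_of_nonneg
              (Finset.filter_subset _ _) fun x _ _ => mul_nonneg (hg x) (by positivity)
        _ = (∑ u ∈ M.filter (fun u => π v < π u),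
              dist (s u) (r u) ^ α / dist (s u) (r v) ^ α) *
            (3 ^ α * ∑ x ∈ M, p x / dist (s x) (r v) ^ α) := by
            rw [Finset.sum_mul]
            refine Finset.sum_congr rfl fun u _ => ?_
            rw [← Finset.sum_mul, ← Finset.mul_sum, mul_comm]
        _ ≤ τ * (3 ^ α * ∑ x ∈ M, p x / dist (s x) (r v) ^ α) := by
            refine mul_le_mul_of_nonneg_right (hsum₁ v hv) ?_
            rw [Finset.mul_sum]
            exact Finset.sum_nonneg fun x _ => hg x
        _ = _ := by ring
    -- The ratios at `r u` are summed over `u` for fixed `x`, by the weight bound at `x`; this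
    -- requires exchanging the sums.
    have hpart₂ : ∑ u ∈ M.filter (fun u => π v < π u), ∑ x ∈ M.filter (fun x => π x < π u),
        3 ^ α * (p x / dist (s x) (r v) ^ α) *
          (dist (s u) (r u) ^ α / dist (s x) (r u) ^ α) ≤
        τ * 3 ^ α * ∑ x ∈ M, p x / dist (s x) (r v) ^ α := by
      calc _ ≤ ∑ u ∈ M, ∑ x ∈ M.filter (fun x => π x < π u),
            3 ^ α * (p x / dist (s x) (r v) ^ α) *
              (dist (s u) (r u) ^ α / dist (s x) (r u) ^ α) :=
            Finset.sum_le_sum_of_subset_of_nonneg (Finset.filter_subset _ _) fun u _ _ =>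
              Finset.sum_nonneg fun x _ => mul_nonneg (hg x) (by positivity)
        _ = ∑ x ∈ M, ∑ u ∈ M.filter (fun u => π x < π u),
            3 ^ α * (p x / dist (s x) (r v) ^ α) *
              (dist (s u) (r u) ^ α / dist (s x) (r u) ^ α) :=
            Finset.sum_comm' fun u x => by simp only [Finset.mem_filter]; tauto
        _ ≤ ∑ x ∈ M, 3 ^ α * (p x / dist (s x) (r v) ^ α) * τ := by
            refine Finset.sum_le_sum fun x hx => ?_
            rw [← Finset.mul_sum]
            exact mul_le_mul_of_nonneg_left (hsum₂ x hx) (hg x)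
        _ = _ := by
            rw [← Finset.sum_mul, ← Finset.mul_sum]; ring
    rw [htotal] at hpart₁ hpart₂
    linarith
  have hHL : H ≤ L + ν' := by
    -- The claim becomes `H ≤ ε(1 + 2β)(L + ν') + εH`, and both coefficients are at most `1 / 2`.
    set ε := 4 * β * 3 ^ α * τ with hε
    have h3 : (1 : ℝ) ≤ 3 ^ α := Real.one_le_rpow (by norm_num) hα.le
    have hε0 : 0 ≤ ε := by positivity
    have hε1 : ε * (1 + 2 * β) ≤ 1 / 2 := by rw [hε]; linarith
    have hbt : 2 * β * (ν' * τ) ≤ ε * ν' := by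
      have h0 : 0 ≤ 2 * β * (ν' * τ) := by positivity
      have := mul_le_mul_of_nonneg_left h3 h0
      rw [hε]
      linarith
    have hmain : H ≤ ε * ν' + ε * (L + H + 2 * β * (L + ν')) := by
      refine hHle.trans ?_
      rw [mul_add]
      refine add_le_add hbt (le_of_eq ?_)
      rw [hε]; ring
    have h₁ : ε ≤ 1 / 2 := by
      have : 0 ≤ ε * (2 * β) := by positivity
      linarith
    have h₂ : ε * H ≤ 1 / 2 * H := mul_le_mul_of_nonneg_right h₁ hH0
    have h₃ : ε * (1 + 2 * β) * (L + ν') ≤ 1 / 2 * (L + ν') :=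
      mul_le_mul_of_nonneg_right hε1 (by positivity)
    linarith
  rw [hsignal, herase]
  have : L + H + ν ≤ 2 * (L + ν') := by linarith
  calc β * (L + H + ν) ≤ β * (2 * (L + ν')) := mul_le_mul_of_nonneg_left this hβ.le
    _ = _ := by ring

end Metric

end SpectrumAuction

namespace SpectrumAuction

/-! ### Feasible sets: how many long links can be close to a point -/

/-- Sum the hypothesis over `i`: each `q j` is counted `|Q| - 1` times on the left and once on the
right. -/
theorem card_le_of_mul_sum_erase_le {ι : Type*} [DecidableEq ι] {Q : Finset ι} {q : ι → ℝ} {γ : ℝ}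
    (hγ : 0 < γ) (hq : ∀ i ∈ Q, 0 < q i) (h : ∀ i ∈ Q, γ * ∑ j ∈ Q.erase i, q j ≤ q i) :
    (Q.card : ℝ) ≤ 1 + 1 / γ := by
  rcases Q.eq_empty_or_nonempty with rfl | hne
  · simp only [Finset.card_empty, Nat.cast_zero]
    positivity
  set P := ∑ i ∈ Q, q i with hP
  have hPpos : 0 < P := Finset.sum_pos hq hne
  have h₁ : ∑ i ∈ Q, γ * (P - q i) ≤ P := by
    refine Finset.sum_le_sum fun i hi => ?_
    rw [hP, ← Finset.sum_erase_add Q q hi, add_sub_cancel_right]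
    exact h i hi
  rw [← Finset.mul_sum, Finset.sum_sub_distrib, Finset.sum_const, nsmul_eq_mul, ← hP] at h₁
  have h₂ : γ * (Q.card - 1) ≤ 1 := by
    refine le_of_mul_le_mul_right ?_ hPpos
    linarith
  rw [← sub_le_iff_le_add', le_div_iff₀ hγ]
  linarith

section Metric

variable {X : Type*} [MetricSpace X] {n : ℕ}

theorem SINR.mono {α β ν : ℝ} (hβ : 0 < β) {s r : Fin n → X} {M Q : Finset (Fin n)}
    {p : Fin n → ℝ} (h : SINR α β ν s r M p) (hQ : Q ⊆ M) : SINR α β ν s r Q p := by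
  intro i hi
  obtain ⟨h₁, h₂, h₃⟩ := h i (hQ hi)
  refine ⟨h₁, fun j hj => h₂ j (Finset.erase_subset_erase i hQ hj), le_trans ?_ h₃⟩
  refine mul_le_mul_of_nonneg_left (add_le_add (Finset.sum_le_sum_of_subset_of_nonneg
    (Finset.erase_subset_erase i hQ) fun j hj _ => ?_) le_rfl) hβ.le
  have := (h j (Finset.mem_of_mem_erase hj)).1
  positivity

theorem SINR.mul_sum_le {α β ν : ℝ} (hβ : 0 < β) (hν : 0 ≤ ν) {s r : Fin n → X}
    {M : Finset (Fin n)} {p : Fin n → ℝ} (h : SINR α β ν s r M p) {i : Fin n} (hi : i ∈ M) :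
    β * ∑ j ∈ M.erase i, p j / dist (s j) (r i) ^ α ≤ p i / dist (s i) (r i) ^ α :=
  le_trans (mul_le_mul_of_nonneg_left (le_add_of_nonneg_right hν) hβ.le) (h i hi).2.2

/-- With senders within `R` of `y`, the distance from `s j` to `r i` is at most `2R + d_i ≤ (3R / t)
d_i`. So the length of `i` cancels and the SINR constraint compares the bare powers of the links. -/
theorem SINR.card_senders_le {α β ν : ℝ} (hα : 0 < α) (hβ : 0 < β) (hν : 0 ≤ ν) {s r : Fin n → X}
    {M : Finset (Fin n)} {p : Fin n → ℝ} (h : SINR α β ν s r M p) {t R : ℝ} (ht : 0 < t)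
    (hM : ∀ u ∈ M, t ≤ dist (s u) (r u)) (hR : t ≤ R) (y : X) :
    ((M.filter fun u => dist (s u) y ≤ R).card : ℝ) ≤ 1 + (3 * R / t) ^ α / β := by
  have hQM := Finset.filter_subset (fun u => dist (s u) y ≤ R) M
  set Q := M.filter fun u => dist (s u) y ≤ R with hQ
  have hQs := h.mono hβ hQM
  have hR0 : 0 < R := ht.trans_le hR
  rw [← one_div_div]
  refine card_le_of_mul_sum_erase_le (q := p) (by positivity) (fun i hi => (hQs i hi).1) ?_
  intro i hi
  have hdi : t ≤ dist (s i) (r i) := hM i (hQM hi)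
  have hdi0 : 0 < dist (s i) (r i) := ht.trans_le hdi
  have hmain := hQs.mul_sum_le hβ hν hi
  rw [le_div_iff₀ (by positivity)] at hmain
  refine le_trans (le_of_eq_of_le ?_ (mul_le_mul_of_nonneg_right (mul_le_mul_of_nonneg_left
    (Finset.sum_le_sum (f := fun j => p j * ((3 * R / t * dist (s i) (r i)) ^ α)⁻¹)
      fun j hj => ?_) hβ.le) (by positivity))) hmain
  · rw [← Finset.sum_mul, Real.mul_rpow (by positivity) hdi0.le]
    field_simp
  · have hjQ := Finset.mem_of_mem_erase hj
    have hpos : 0 < dist (s j) (r i) := dist_pos.mpr ((hQs i hi).2.1 j hj)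
    have hpj := (hQs j hjQ).1
    simp only [div_eq_mul_inv (p j)]
    refine mul_le_mul_of_nonneg_left (inv_anti₀ (by positivity)
      (Real.rpow_le_rpow hpos.le ?_ hα.le)) hpj.le
    have h₁ := dist_triangle4 (s j) y (s i) (r i)
    have h₂ := (Finset.mem_filter.mp hjQ).2
    have h₃ := (Finset.mem_filter.mp hi).2
    rw [dist_comm] at h₃
    rw [div_mul_eq_mul_div, le_div_iff₀ ht]
    nlinarith

/-- Now the distance from `s j` to `r i` is at most `d_j + 2R ≤ (3R / t) d_j`, in terms of the
interferer's length. The quantities to compare are therefore the received signal strengths `p i /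
d_i ^ α`. -/
theorem SINR.card_receivers_le {α β ν : ℝ} (hα : 0 < α) (hβ : 0 < β) (hν : 0 ≤ ν)
    {s r : Fin n → X} {M : Finset (Fin n)} {p : Fin n → ℝ} (h : SINR α β ν s r M p) {t R : ℝ}
    (ht : 0 < t) (hM : ∀ u ∈ M, t ≤ dist (s u) (r u)) (hR : t ≤ R) (y : X) :
    ((M.filter fun u => dist (r u) y ≤ R).card : ℝ) ≤ 1 + (3 * R / t) ^ α / β := by
  have hQM := Finset.filter_subset (fun u => dist (r u) y ≤ R) M
  set Q := M.filter fun u => dist (r u) y ≤ R with hQ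
  have hQs := h.mono hβ hQM
  have hR0 : 0 < R := ht.trans_le hR
  have hd0 : ∀ i ∈ Q, 0 < dist (s i) (r i) := fun i hi => ht.trans_le (hM i (hQM hi))
  rw [← one_div_div]
  refine card_le_of_mul_sum_erase_le (q := fun i => p i / dist (s i) (r i) ^ α) (by positivity)
    (fun i hi => div_pos (hQs i hi).1 (Real.rpow_pos_of_pos (hd0 i hi) α)) ?_
  intro i hi
  refine le_trans ?_ (hQs.mul_sum_le hβ hν hi)
  rw [div_mul_eq_mul_div, ← mul_div_assoc', Finset.sum_div]
  refine mul_le_mul_of_nonneg_left (Finset.sum_le_sum fun j hj => ?_) hβ.le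
  have hjQ := Finset.mem_of_mem_erase hj
  have hpos : 0 < dist (s j) (r i) := dist_pos.mpr ((hQs i hi).2.1 j hj)
  have hpj := (hQs j hjQ).1
  have hdj := hd0 j hjQ
  rw [div_div, ← Real.mul_rpow hdj.le (by positivity)]
  refine div_le_div_of_nonneg_left hpj.le (by positivity) (Real.rpow_le_rpow hpos.le ?_ hα.le)
  have h₁ := dist_triangle4 (s j) (r j) y (r i)
  have h₂ := (Finset.mem_filter.mp hjQ).2
  have h₃ := (Finset.mem_filter.mp hi).2
  have h₄ := hM j (hQM hjQ)
  rw [dist_comm] at h₃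
  rw [mul_div_assoc', le_div_iff₀ ht]
  nlinarith

/-- In a metric space with packing, bounds on the number of points in small balls carry over to
large balls. -/
theorem HasPacking.card_filter_le {C δ : ℝ} (hX : HasPacking X C δ) {ι : Type*} (f : ι → X)
    (M : Finset ι) {t N R : ℝ} (ht : 0 < t) (hR : t ≤ R)
    (hN : ∀ y, ((M.filter fun u => dist (f u) y ≤ t).card : ℝ) ≤ N) (x : X) :
    ((M.filter fun u => dist (f u) x ≤ R).card : ℝ) ≤ C * (R / t) ^ δ * N := by
  classical
  set Q := M.filter fun u => dist (f u) x ≤ R with hQ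
  -- A `t`-separated set of images of maximum size: packing bounds its size, and by maximality its
  -- `t`-balls cover all of `Q`.
  let F := (Q.image f).powerset.filter fun P => ∀ y ∈ P, ∀ z ∈ P, y ≠ z → t ≤ dist y z
  have hF : F.Nonempty := ⟨∅, by simp [F]⟩
  obtain ⟨P, hP, hmax⟩ := F.exists_max_image Finset.card hF
  simp only [F, Finset.mem_filter, Finset.mem_powerset] at hP hmax
  have hcover : ∀ u ∈ Q, ∃ y ∈ P, dist (f u) y ≤ t := by
    intro u hu
    by_contra! hfar
    have hnot : f u ∉ P := fun hmem => by
      have := hfar _ hmem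
      rw [dist_self] at this
      exact absurd this ht.not_gt
    have hcard := hmax (insert (f u) P) ⟨Finset.insert_subset (Finset.mem_image_of_mem f hu) hP.1,
      by
        intro y hy z hz hyz
        rw [Finset.mem_insert] at hy hz
        rcases hy with rfl | hy <;> rcases hz with rfl | hz
        · exact absurd rfl hyz
        · exact (hfar z hz).le
        · rw [dist_comm]; exact (hfar y hy).le
        · exact hP.2 y hy z hz hyz⟩
    rw [Finset.card_insert_of_notMem hnot] at hcard
    omega
  have hPcard : (P.card : ℝ) ≤ C * (R / t) ^ δ := by
    refine hX x R t ht hR P (fun y hy => ?_) hP.2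
    obtain ⟨u, hu, rfl⟩ := Finset.mem_image.mp (hP.1 hy)
    exact (Finset.mem_filter.mp hu).2
  have hsub : Q ⊆ P.biUnion fun y => M.filter fun u => dist (f u) y ≤ t := by
    intro u hu
    obtain ⟨y, hy, huy⟩ := hcover u hu
    exact Finset.mem_biUnion.mpr ⟨y, hy, Finset.mem_filter.mpr ⟨Finset.filter_subset _ _ hu, huy⟩⟩
  have hN0 : 0 ≤ N := le_trans (Nat.cast_nonneg _) (hN x)
  calc (Q.card : ℝ) ≤ ((∑ y ∈ P, (M.filter fun u => dist (f u) y ≤ t).card : ℕ) : ℝ) := by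
        exact_mod_cast (Finset.card_le_card hsub).trans Finset.card_biUnion_le
    _ ≤ ∑ y ∈ P, N := by
        push_cast
        exact Finset.sum_le_sum fun y _ => hN y
    _ = P.card * N := by rw [Finset.sum_const, nsmul_eq_mul]
    _ ≤ _ := mul_le_mul_of_nonneg_right hPcard hN0

end Metric

/-! ### Dyadic summation -/

/-- The first scale `2 ^ m * t` that reaches `x` already dominates the ratio, up to the factor `2 ^
α` lost within a scale. The last term covers an `x` beyond all `L` scales. -/
theorem cappedRatio_le_dyadic {α t x : ℝ} (hα : 0 < α) (ht : 0 < t) (L : ℕ) :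
    cappedRatio α t x ≤ 2 ^ α * ∑ m ∈ Finset.range L,
      (if x ≤ 2 ^ m * t then (((2 : ℝ) ^ m) ^ α)⁻¹ else 0) + 2 ^ α * (((2 : ℝ) ^ L) ^ α)⁻¹ := by
  have h2 : (1 : ℝ) ≤ 2 ^ α := Real.one_le_rpow (by norm_num) hα.le
  induction L with
  | zero =>
    simp only [Finset.range_zero, Finset.sum_empty, mul_zero, zero_add, pow_zero, Real.one_rpow,
      inv_one, mul_one]
    exact (cappedRatio_le_one _ _ _).trans h2
  | succ L ih =>
    rw [Finset.sum_range_succ]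
    split_ifs with hx
    · refine ih.trans ?_
      have : (0 : ℝ) ≤ 2 ^ α * (((2 : ℝ) ^ (L + 1)) ^ α)⁻¹ := by positivity
      linarith
    · refine (cappedRatio_le_of_le hα ht (by positivity : (0 : ℝ) < 2 ^ L) (not_le.mp hx).le).trans ?_
      have h₁ : (2 : ℝ) ^ α * (((2 : ℝ) ^ (L + 1)) ^ α)⁻¹ = (((2 : ℝ) ^ L) ^ α)⁻¹ := by
        rw [pow_succ, Real.mul_rpow (by positivity) (by norm_num)]
        field_simp
      have h₂ : (0 : ℝ) ≤ ∑ m ∈ Finset.range L,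
          (if x ≤ 2 ^ m * t then (((2 : ℝ) ^ m) ^ α)⁻¹ else 0) :=
        Finset.sum_nonneg fun m _ => by split_ifs <;> positivity
      rw [h₁]
      have : (0 : ℝ) ≤ 2 ^ α * (∑ m ∈ Finset.range L,
          (if x ≤ 2 ^ m * t then (((2 : ℝ) ^ m) ^ α)⁻¹ else 0) + 0) := by positivity
      linarith

/-- Exchange links and scales. With `L` large enough, the tails of all links together contribute at
most `2 ^ α`, which is the `1` in the bracket. -/
theorem sum_cappedRatio_le {α t : ℝ} (hα : 0 < α) (ht : 0 < t) {ι : Type*} (M : Finset ι)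
    (x : ι → ℝ) (N : ℕ → ℝ) (hN : ∀ m, ((M.filter fun u => x u ≤ 2 ^ m * t).card : ℝ) ≤ N m)
    {L : ℕ} (hL : (M.card : ℝ) ≤ ((2 : ℝ) ^ L) ^ α) :
    ∑ u ∈ M, cappedRatio α t (x u) ≤
      2 ^ α * (∑ m ∈ Finset.range L, (((2 : ℝ) ^ m) ^ α)⁻¹ * N m + 1) := by
  refine (Finset.sum_le_sum fun u _ => cappedRatio_le_dyadic hα ht L).trans ?_
  rw [Finset.sum_add_distrib, ← Finset.mul_sum, Finset.sum_comm, Finset.sum_const, nsmul_eq_mul,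
    mul_add, mul_one]
  refine add_le_add (mul_le_mul_of_nonneg_left (Finset.sum_le_sum fun m _ => ?_) (by positivity)) ?_
  · rw [← Finset.sum_filter, Finset.sum_const, nsmul_eq_mul, mul_comm]
    exact mul_le_mul_of_nonneg_left (hN m) (by positivity)
  · have h₁ : (M.card : ℝ) * (((2 : ℝ) ^ L) ^ α)⁻¹ ≤ 1 := by
      rwa [← div_eq_mul_inv, div_le_one (by positivity)]
    calc (M.card : ℝ) * (2 ^ α * (((2 : ℝ) ^ L) ^ α)⁻¹)
        = 2 ^ α * ((M.card : ℝ) * (((2 : ℝ) ^ L) ^ α)⁻¹) := by ring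
      _ ≤ 2 ^ α * 1 := mul_le_mul_of_nonneg_left h₁ (by positivity)
      _ = _ := mul_one _

/-- A number of dyadic scales that suffices for `n` links. -/
theorem exists_dyadic_scales {α : ℝ} (hα : 0 < α) {n : ℕ} (hn : 2 ≤ n) :
    ∃ L : ℕ, (n : ℝ) ≤ ((2 : ℝ) ^ L) ^ α ∧
      (L : ℝ) ≤ (1 / (α * Real.log 2) + 1 / Real.log 2) * Real.log n := by
  have hlog2 : 0 < Real.log 2 := Real.log_pos (by norm_num)
  have hlogn : Real.log 2 ≤ Real.log n := Real.log_le_log (by norm_num) (by exact_mod_cast hn)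
  -- The least `L` with `2 ^ (L α) ≥ n`; the error of rounding up is absorbed by `log n / log 2 ≥
  -- 1`.
  refine ⟨⌈Real.log n / (α * Real.log 2)⌉₊, ?_, ?_⟩
  · have hn0 : (0 : ℝ) < n := by exact_mod_cast (by omega : 0 < n)
    rw [← Real.log_le_log_iff hn0 (by positivity), Real.log_rpow (by positivity), Real.log_pow]
    have h := Nat.le_ceil (Real.log n / (α * Real.log 2))
    rw [div_le_iff₀ (by positivity)] at h
    linarith
  · have h := (Nat.ceil_lt_add_one (a := Real.log n / (α * Real.log 2))
      (div_nonneg (hlog2.le.trans hlogn) (by positivity))).le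
    have h₁ : 1 ≤ Real.log n / Real.log 2 := (one_le_div hlog2).mpr hlogn
    calc _ ≤ _ := h
      _ ≤ Real.log n / (α * Real.log 2) + Real.log n / Real.log 2 := by linarith
      _ = _ := by ring

/-- The count grows exactly as fast as the ratio decays, so every scale contributes at most `1 + A`
and the number of scales gives the logarithm. -/
theorem sum_cappedRatio_le_log {α : ℝ} (hα : 0 < α) {A t : ℝ} (ht : 0 < t) (hA : 0 ≤ A) {n : ℕ}
    (hn : 2 ≤ n) (M : Finset (Fin n)) (x : Fin n → ℝ)
    (hN : ∀ R, t ≤ R → ((M.filter fun u => x u ≤ R).card : ℝ) ≤ 1 + A * (R / t) ^ α) :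
    ∑ u ∈ M, cappedRatio α t (x u) ≤ 2 ^ α * ((1 + A) * (1 / (α * Real.log 2) + 1 / Real.log 2) +
      1 / Real.log 2) * Real.log n := by
  obtain ⟨L, hL₁, hL₂⟩ := exists_dyadic_scales hα hn
  have hlog2 : 0 < Real.log 2 := Real.log_pos (by norm_num)
  have hlogn : Real.log 2 ≤ Real.log n := Real.log_le_log (by norm_num) (by exact_mod_cast hn)
  have hcard : (M.card : ℝ) ≤ n := by exact_mod_cast card_finset_fin_le M
  refine (sum_cappedRatio_le hα ht M x (fun m => 1 + A * ((2 : ℝ) ^ m) ^ α) (fun m => ?_)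
    (hcard.trans hL₁)).trans ?_
  · have h := hN (2 ^ m * t) (le_mul_of_one_le_left ht.le (one_le_pow₀ (by norm_num)))
    rwa [mul_div_cancel_right₀ _ ht.ne'] at h
  rw [mul_assoc]
  refine mul_le_mul_of_nonneg_left ?_ (by positivity)
  have h₁ : ∑ m ∈ Finset.range L, (((2 : ℝ) ^ m) ^ α)⁻¹ * (1 + A * ((2 : ℝ) ^ m) ^ α) ≤
      L * (1 + A) := by
    calc _ ≤ ∑ m ∈ Finset.range L, (1 + A) := by
          refine Finset.sum_le_sum fun m _ => ?_
          have h2 : (1 : ℝ) ≤ ((2 : ℝ) ^ m) ^ α :=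
            Real.one_le_rpow (one_le_pow₀ (by norm_num)) hα.le
          rw [inv_mul_le_iff₀ (by positivity)]
          nlinarith
      _ = _ := by rw [Finset.sum_const, Finset.card_range, nsmul_eq_mul]
  have h₂ : (L : ℝ) * (1 + A) ≤ _ := mul_le_mul_of_nonneg_right hL₂ (by linarith)
  have h₃ : 1 ≤ 1 / Real.log 2 * Real.log n := by
    rw [one_div, ← div_eq_inv_mul, one_le_div hlog2]
    exact hlogn
  linarith

/-- Slower growth of the count makes scale `m` contribute `A * (2 ^ (δ - α)) ^ m`, so the bound does
not depend on the number of scales. -/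
theorem sum_cappedRatio_le_geometric {α δ : ℝ} (hα : 0 < α) (hδ : δ < α) {A t : ℝ} (ht : 0 < t)
    (hA : 0 ≤ A) {n : ℕ} (hn : 2 ≤ n) (M : Finset (Fin n)) (x : Fin n → ℝ)
    (hN : ∀ R, t ≤ R → ((M.filter fun u => x u ≤ R).card : ℝ) ≤ A * (R / t) ^ δ) :
    ∑ u ∈ M, cappedRatio α t (x u) ≤ 2 ^ α * (A * (1 - 2 ^ (δ - α))⁻¹ + 1) := by
  obtain ⟨L, hL₁, -⟩ := exists_dyadic_scales hα hn
  have hcard : (M.card : ℝ) ≤ n := by exact_mod_cast card_finset_fin_le M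
  refine (sum_cappedRatio_le hα ht M x (fun m => A * ((2 : ℝ) ^ m) ^ δ) (fun m => ?_)
    (hcard.trans hL₁)).trans ?_
  · have h := hN (2 ^ m * t) (le_mul_of_one_le_left ht.le (one_le_pow₀ (by norm_num)))
    rwa [mul_div_cancel_right₀ _ ht.ne'] at h
  refine mul_le_mul_of_nonneg_left (add_le_add ?_ le_rfl) (by positivity)
  have hq₁ : (2 : ℝ) ^ (δ - α) < 1 :=
    Real.rpow_lt_one_of_one_lt_of_neg (by norm_num) (by linarith)
  have hq₀ : (0 : ℝ) ≤ 2 ^ (δ - α) := by positivity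
  calc _ = A * ∑ m ∈ Finset.range L, ((2 : ℝ) ^ (δ - α)) ^ m := by
        rw [Finset.mul_sum]
        refine Finset.sum_congr rfl fun m _ => ?_
        rw [← Real.rpow_natCast, ← Real.rpow_natCast, ← Real.rpow_mul (by norm_num),
          ← Real.rpow_mul (by norm_num), ← Real.rpow_mul (by norm_num),
          ← Real.rpow_neg (by norm_num), mul_left_comm, ← Real.rpow_add (by norm_num)]
        ring_nf
    _ ≤ A * (1 - 2 ^ (δ - α))⁻¹ := by
        refine mul_le_mul_of_nonneg_left ?_ hA
        rw [← tsum_geometric_of_lt_one hq₀ hq₁]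
        exact (summable_geometric_of_lt_one hq₀ hq₁).sum_le_tsum _ fun m _ => pow_nonneg hq₀ m

/-! ### Weights between a link and the longer links of a feasible set -/

section Metric

variable {X : Type*} [MetricSpace X] {n : ℕ}

/-- The weight of a link to longer links, in terms of capped ratios. -/
theorem sum_symmWeight_le {α τ B : ℝ} (hτ : 0 < τ) {s r : Fin n → X} {π : Fin n ≃ Fin n}
    {M : Finset (Fin n)} {v : Fin n} (hM : ∀ u ∈ M, π u < π v)
    (hs : ∑ u ∈ M, cappedRatio α (dist (s v) (r v)) (dist (s u) (r v)) ≤ B)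
    (hr : ∑ u ∈ M, cappedRatio α (dist (s v) (r v)) (dist (r u) (s v)) ≤ B) :
    ∑ u ∈ M, symmWeight (weight α τ s r π) u v ≤ 2 * B / τ := by
  calc _ = 1 / τ * (∑ u ∈ M, cappedRatio α (dist (s v) (r v)) (dist (r u) (s v)) +
        ∑ u ∈ M, cappedRatio α (dist (s v) (r v)) (dist (s u) (r v))) := by
        rw [← Finset.sum_add_distrib, Finset.mul_sum]
        refine Finset.sum_congr rfl fun u hu => ?_
        rw [symmWeight_comm, symmWeight_weight_of_lt (hM u hu), dist_comm (s v) (r u)]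
    _ ≤ 1 / τ * (B + B) := mul_le_mul_of_nonneg_left (add_le_add hr hs) (by positivity)
    _ = _ := by ring

/-- The links of `M` precede `v`, hence are at least as long, so the counting lemmas apply with `t`
the length of `v`: senders around `r v` for one half of the weight, receivers around `s v` for the
other. -/
theorem SINR.sum_symmWeight_le_log {α β ν τ : ℝ} (hα : 0 < α) (hβ : 0 < β) (hτ : 0 < τ)
    (hν : 0 ≤ ν) (hn : 2 ≤ n) {s r : Fin n → X} (hsr : ∀ v, s v ≠ r v) {π : Fin n ≃ Fin n}
    (hπ : ∀ u v, π u < π v → dist (s v) (r v) ≤ dist (s u) (r u)) {M : Finset (Fin n)}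
    {p : Fin n → ℝ} (h : SINR α β ν s r M p) {v : Fin n} (hM : ∀ u ∈ M, π u < π v) :
    ∑ u ∈ M, symmWeight (weight α τ s r π) u v ≤
      2 * (2 ^ α * ((1 + 3 ^ α / β) * (1 / (α * Real.log 2) + 1 / Real.log 2) +
        1 / Real.log 2) * Real.log n) / τ := by
  have ht : 0 < dist (s v) (r v) := dist_pos.mpr (hsr v)
  have hlen : ∀ u ∈ M, dist (s v) (r v) ≤ dist (s u) (r u) := fun u hu => hπ u v (hM u hu)
  have hscale : ∀ R, dist (s v) (r v) ≤ R → 1 + (3 * R / dist (s v) (r v)) ^ α / β =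
      1 + 3 ^ α / β * (R / dist (s v) (r v)) ^ α := fun R hR => by
    rw [mul_div_assoc, Real.mul_rpow (by norm_num) (div_nonneg (ht.le.trans hR) ht.le)]
    ring
  exact sum_symmWeight_le hτ hM
    (sum_cappedRatio_le_log hα ht (by positivity) hn M _ fun R hR =>
      (h.card_senders_le hα hβ hν ht hlen hR (r v)).trans_eq (hscale R hR))
    (sum_cappedRatio_le_log hα ht (by positivity) hn M _ fun R hR =>
      (h.card_receivers_le hα hβ hν ht hlen hR (s v)).trans_eq (hscale R hR))

theorem HasPacking.nonneg {C δ : ℝ} (hX : HasPacking X C δ) (x : X) : 0 ≤ C := by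
  have h := hX x 1 1 one_pos le_rfl ∅ (by simp) (by simp)
  simpa using h

/-- Feasibility is used only at radius `t`, where it allows `1 + 3 ^ α / β` links per ball; packing
extends this to all larger radii. -/
theorem SINR.sum_symmWeight_le_of_hasPacking {α β ν τ C δ : ℝ} (hα : 0 < α) (hβ : 0 < β)
    (hτ : 0 < τ) (hν : 0 ≤ ν) (hδ : δ < α) (hX : HasPacking X C δ) (hn : 2 ≤ n) {s r : Fin n → X}
    (hsr : ∀ v, s v ≠ r v) {π : Fin n ≃ Fin n}
    (hπ : ∀ u v, π u < π v → dist (s v) (r v) ≤ dist (s u) (r u)) {M : Finset (Fin n)}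
    {p : Fin n → ℝ} (h : SINR α β ν s r M p) {v : Fin n} (hM : ∀ u ∈ M, π u < π v) :
    ∑ u ∈ M, symmWeight (weight α τ s r π) u v ≤
      2 * (2 ^ α * (C * (1 + 3 ^ α / β) * (1 - 2 ^ (δ - α))⁻¹ + 1)) / τ := by
  have ht : 0 < dist (s v) (r v) := dist_pos.mpr (hsr v)
  have hlen : ∀ u ∈ M, dist (s v) (r v) ≤ dist (s u) (r u) := fun u hu => hπ u v (hM u hu)
  have hC : 0 ≤ C := hX.nonneg (s v)
  have hscale : 3 * dist (s v) (r v) / dist (s v) (r v) = 3 := mul_div_cancel_right₀ _ ht.ne'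
  refine sum_symmWeight_le hτ hM
    (sum_cappedRatio_le_geometric hα hδ ht (by positivity) hn M _ fun R hR => ?_)
    (sum_cappedRatio_le_geometric hα hδ ht (by positivity) hn M _ fun R hR => ?_)
  · refine (hX.card_filter_le s M ht hR (fun y => ?_) (r v)).trans_eq (mul_right_comm _ _ _)
    have h₁ := h.card_senders_le hα hβ hν ht hlen le_rfl y
    rwa [hscale] at h₁
  · refine (hX.card_filter_le r M ht hR (fun y => ?_) (s v)).trans_eq (mul_right_comm _ _ _)
    have h₁ := h.card_receivers_le hα hβ hν ht hlen le_rfl y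
    rwa [hscale] at h₁

end Metric

end SpectrumAuction

namespace SpectrumAuction

variable {n k : ℕ}

/-! ### Conflicts in allocations -/

/-- The total weight between `v` and the links in `P` whose bundle under `S` meets `T`. -/
def conflict (wb : Fin n → Fin n → ℝ) (P : Fin n → Prop) [DecidablePred P] (S : Alloc n k)
    (T : Finset (Fin k)) (v : Fin n) : ℝ :=
  ∑ u ∈ Finset.univ.filter (fun u => P u ∧ (T ∩ S u).Nonempty), wb u v

theorem conflict_mono {wb : Fin n → Fin n → ℝ} (hwb : ∀ u v, 0 ≤ wb u v) (P : Fin n → Prop)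
    [DecidablePred P] {S S' : Alloc n k} {T : Finset (Fin k)} {v : Fin n}
    (h : ∀ u, P u → S u ⊆ S' u) : conflict wb P S T v ≤ conflict wb P S' T v := by
  refine Finset.sum_le_sum_of_subset_of_nonneg (fun u hu => ?_) fun u _ _ => hwb u v
  simp only [Finset.mem_filter, Finset.mem_univ, true_and] at hu ⊢
  exact ⟨hu.1, hu.2.mono (Finset.inter_subset_inter_left (h u hu.1))⟩

theorem conflict_empty (wb : Fin n → Fin n → ℝ) (P : Fin n → Prop) [DecidablePred P]
    (S : Alloc n k) (v : Fin n) : conflict wb P S ∅ v = 0 := by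
  simp [conflict]

/-- The allocation `S` is partly feasible: the weight of every link to earlier links that share a
channel with it is less than `1 / 2`. -/
def PartlyFeasible (π : Fin n ≃ Fin n) (wb : Fin n → Fin n → ℝ) (S : Alloc n k) : Prop :=
  ∀ v, conflict wb (fun u => π u < π v) S (S v) v < 1 / 2

/-! ### Partial conflict resolution -/

/-- Treatment of a single link in the partial conflict resolution. -/
noncomputable def partialStep (π : Fin n ≃ Fin n) (wb : Fin n → Fin n → ℝ) (S : Alloc n k) (v : Fin n) :
    Alloc n k :=
  if 1 / 2 ≤ conflict wb (fun u => π u < π v) S (S v) v then Function.update S v ∅ else S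

theorem partialStep_eq_of_ne (π : Fin n ≃ Fin n) (wb : Fin n → Fin n → ℝ) (S : Alloc n k)
    {v w : Fin n} (h : w ≠ v) : partialStep π wb S v w = S w := by
  unfold partialStep
  split_ifs
  · exact Function.update_of_ne h _ _
  · rfl

theorem partialStep_subset (π : Fin n ≃ Fin n) (wb : Fin n → Fin n → ℝ) (S : Alloc n k)
    (v w : Fin n) : partialStep π wb S v w ⊆ S w := by
  rcases eq_or_ne w v with rfl | h
  · unfold partialStep
    split_ifs
    · rw [Function.update_self]
      exact Finset.empty_subset _
    · exact subset_rfl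
  · rw [partialStep_eq_of_ne π wb S h]

theorem foldl_partialStep_of_notMem (π : Fin n ≃ Fin n) (wb : Fin n → Fin n → ℝ)
    (l : List (Fin n)) (S : Alloc n k) {w : Fin n} (h : w ∉ l) :
    l.foldl (partialStep π wb) S w = S w := by
  induction l generalizing S with
  | nil => rfl
  | cons v l ih =>
    rw [List.mem_cons, not_or] at h
    rw [List.foldl_cons, ih _ h.2, partialStep_eq_of_ne π wb S h.1]

/-- Links are treated by increasing `π`, so all earlier links are already final when `v` is treated.
-/
theorem foldl_partialStep_conflict_lt (π : Fin n ≃ Fin n) (wb : Fin n → Fin n → ℝ)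
    (l : List (Fin n)) (hl : l.Pairwise fun u v => π u < π v) (S : Alloc n k) {v : Fin n}
    (hv : v ∈ l) :
    conflict wb (fun u => π u < π v) (l.foldl (partialStep π wb) S)
      (l.foldl (partialStep π wb) S v) v < 1 / 2 := by
  induction l generalizing S with
  | nil => exact absurd hv List.not_mem_nil
  | cons w l ih =>
    rw [List.pairwise_cons] at hl
    rw [List.foldl_cons]
    by_cases hvl : v ∈ l
    · exact ih hl.2 _ hvl
    obtain rfl : v = w := (List.mem_cons.mp hv).resolve_right hvl
    rw [foldl_partialStep_of_notMem π wb l _ hvl]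
    have heq : conflict wb (fun u => π u < π v) (l.foldl (partialStep π wb) (partialStep π wb S v))
        (partialStep π wb S v v) v =
        conflict wb (fun u => π u < π v) S (partialStep π wb S v v) v := by
      refine Finset.sum_congr (Finset.filter_congr fun u _ => and_congr_right fun hu => ?_)
        fun _ _ => rfl
      have hul : u ∉ l := fun h => (hl.1 u h).not_gt hu
      have huv : u ≠ v := fun h => by rw [h] at hu; exact lt_irrefl _ hu
      rw [foldl_partialStep_of_notMem π wb l _ hul, partialStep_eq_of_ne π wb S huv]
    rw [heq]
    by_cases hc : 1 / 2 ≤ conflict wb (fun u => π u < π v) S (S v) v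
    · rw [partialStep, if_pos hc, Function.update_self, conflict_empty]
      norm_num
    · rw [partialStep, if_neg hc]
      exact not_le.mp hc

/-- Bundles only shrink, so a conflict that is small at the start is still small when `v` is
treated. This allows survival to be judged on the tentative allocation alone. -/
theorem foldl_partialStep_eq_self (π : Fin n ≃ Fin n) {wb : Fin n → Fin n → ℝ}
    (hwb : ∀ u v, 0 ≤ wb u v) (l : List (Fin n)) (hl : l.Pairwise fun u v => π u < π v)
    (S : Alloc n k) {v : Fin n} (hv : conflict wb (fun u => π u < π v) S (S v) v < 1 / 2) :
    l.foldl (partialStep π wb) S v = S v := by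
  induction l generalizing S with
  | nil => rfl
  | cons w l ih =>
    rw [List.pairwise_cons] at hl
    rw [List.foldl_cons]
    rcases eq_or_ne v w with rfl | hvw
    · rw [foldl_partialStep_of_notMem π wb l _ fun h => lt_irrefl _ (hl.1 v h), partialStep,
        if_neg hv.not_ge]
    · have heq := partialStep_eq_of_ne π wb S hvw
      rw [ih hl.2 _ ?_, heq]
      rw [heq]
      exact (conflict_mono hwb _ fun u _ => partialStep_subset π wb S w u).trans_lt hv

theorem pairwise_map_symm_finRange (π : Fin n ≃ Fin n) :
    ((List.finRange n).map π.symm).Pairwise fun u v => π u < π v := by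
  rw [List.pairwise_map]
  simp only [Equiv.apply_symm_apply]
  exact List.sortedLT_finRange n |>.pairwise

theorem mem_map_symm_finRange (π : Fin n ≃ Fin n) (v : Fin n) :
    v ∈ (List.finRange n).map π.symm :=
  List.mem_map.mpr ⟨π v, List.mem_finRange _, π.symm_apply_apply v⟩

theorem partlyFeasible_partialResolve (π : Fin n ≃ Fin n) (wb : Fin n → Fin n → ℝ)
    (S : Alloc n k) : PartlyFeasible π wb (partialResolve π wb S) := fun v =>
  foldl_partialStep_conflict_lt π wb _ (pairwise_map_symm_finRange π) S
    (mem_map_symm_finRange π v)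

theorem partialResolve_eq_self (π : Fin n ≃ Fin n) {wb : Fin n → Fin n → ℝ}
    (hwb : ∀ u v, 0 ≤ wb u v) (S : Alloc n k) {v : Fin n}
    (hv : conflict wb (fun u => π u < π v) S (S v) v < 1 / 2) :
    partialResolve π wb S v = S v :=
  foldl_partialStep_eq_self π hwb _ (pairwise_map_symm_finRange π) S hv

/-! ### Rounds of full conflict resolution -/

/-- Treatment of a single link in a round of full conflict resolution. -/
noncomputable def roundStep (wb : Fin n → Fin n → ℝ) (st : Alloc n k × Finset (Fin n)) (v : Fin n) :
    Alloc n k × Finset (Fin n) :=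
  if ∑ u ∈ Finset.univ.filter (fun u => (st.1 v ∩ st.1 u).Nonempty), wb u v < 1
  then (st.1, st.2.erase v)
  else (Function.update st.1 v ∅, st.2)

theorem roundStep_fst_of_ne (wb : Fin n → Fin n → ℝ) (st : Alloc n k × Finset (Fin n))
    {v w : Fin n} (h : w ≠ v) : (roundStep wb st v).1 w = st.1 w := by
  unfold roundStep
  split_ifs
  · rfl
  · exact Function.update_of_ne h _ _

theorem roundStep_snd_of_ne (wb : Fin n → Fin n → ℝ) (st : Alloc n k × Finset (Fin n))
    {v w : Fin n} (h : w ≠ v) : w ∈ (roundStep wb st v).2 ↔ w ∈ st.2 := by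
  unfold roundStep
  split_ifs
  · rw [Finset.mem_erase, and_iff_right h]
  · rfl

theorem roundStep_fst_subset (wb : Fin n → Fin n → ℝ) (st : Alloc n k × Finset (Fin n))
    (v w : Fin n) : (roundStep wb st v).1 w ⊆ st.1 w := by
  rcases eq_or_ne w v with rfl | h
  · unfold roundStep
    split_ifs
    · exact subset_rfl
    · simp
  · rw [roundStep_fst_of_ne wb st h]

theorem foldl_roundStep_of_notMem (wb : Fin n → Fin n → ℝ) (l : List (Fin n))
    (st : Alloc n k × Finset (Fin n)) {w : Fin n} (h : w ∉ l) :
    (l.foldl (roundStep wb) st).1 w = st.1 w ∧ (w ∈ (l.foldl (roundStep wb) st).2 ↔ w ∈ st.2) := by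
  induction l generalizing st with
  | nil => exact ⟨rfl, Iff.rfl⟩
  | cons v l ih =>
    rw [List.mem_cons, not_or] at h
    rw [List.foldl_cons]
    exact ⟨(ih _ h.2).1.trans (roundStep_fst_of_ne wb st h.1),
      (ih _ h.2).2.trans (roundStep_snd_of_ne wb st h.1)⟩

theorem foldl_roundStep_subset (wb : Fin n → Fin n → ℝ) (l : List (Fin n))
    (st : Alloc n k × Finset (Fin n)) (w : Fin n) :
    (l.foldl (roundStep wb) st).1 w ⊆ st.1 w := by
  induction l generalizing st with
  | nil => exact subset_rfl
  | cons v l ih => exact (ih _).trans (roundStep_fst_subset wb st v w)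

theorem foldl_roundStep_of_mem (wb : Fin n → Fin n → ℝ) (l : List (Fin n)) (hl : l.Nodup)
    (st : Alloc n k × Finset (Fin n)) {v : Fin n} (hv : v ∈ l) (hst : v ∈ st.2) :
    ((l.foldl (roundStep wb) st).1 v = st.1 v ∧ v ∉ (l.foldl (roundStep wb) st).2) ∨
      ((l.foldl (roundStep wb) st).1 v = ∅ ∧ v ∈ (l.foldl (roundStep wb) st).2) := by
  induction l generalizing st with
  | nil => exact absurd hv List.not_mem_nil
  | cons w l ih =>
    rw [List.nodup_cons] at hl
    rw [List.foldl_cons]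
    rcases eq_or_ne v w with rfl | hvw
    · obtain ⟨h₁, h₂⟩ := foldl_roundStep_of_notMem wb l (roundStep wb st v) hl.1
      rw [h₁, h₂]
      unfold roundStep
      split_ifs
      · exact Or.inl ⟨rfl, Finset.notMem_erase _ _⟩
      · exact Or.inr ⟨Function.update_self _ _ _, hst⟩
    · have h := ih hl.2 (roundStep wb st w) ((List.mem_cons.mp hv).resolve_left hvw)
        ((roundStep_snd_of_ne wb st hvw).mpr hst)
      rwa [roundStep_fst_of_ne wb st hvw] at h

/-- The test is passed when `v` is treated, and later steps only shrink bundles; a removed link has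
an empty bundle and no conflicts. -/
theorem foldl_roundStep_sum_lt {wb : Fin n → Fin n → ℝ} (hwb : ∀ u v, 0 ≤ wb u v)
    (l : List (Fin n)) (hl : l.Nodup) (st : Alloc n k × Finset (Fin n)) {v : Fin n} (hv : v ∈ l) :
    conflict wb (fun _ => True) (l.foldl (roundStep wb) st).1
      ((l.foldl (roundStep wb) st).1 v) v < 1 := by
  induction l generalizing st with
  | nil => exact absurd hv List.not_mem_nil
  | cons w l ih =>
    rw [List.nodup_cons] at hl
    rw [List.foldl_cons]
    by_cases hvl : v ∈ l
    · exact ih hl.2 _ hvl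
    obtain rfl : v = w := (List.mem_cons.mp hv).resolve_right hvl
    rw [(foldl_roundStep_of_notMem wb l (roundStep wb st v) hvl).1]
    refine (conflict_mono hwb _ fun u _ => foldl_roundStep_subset wb l _ u).trans_lt ?_
    unfold roundStep
    split_ifs with hc
    · simpa only [conflict, true_and] using hc
    · dsimp only
      rw [Function.update_self, conflict_empty]
      exact one_pos

/-- When `v` is rejected, links later in `π` have already been treated and are final, while those
earlier in `π` hold at most their initial bundles. The failed test thus splits into these two sums.
-/
theorem foldl_roundStep_removed (π : Fin n ≃ Fin n) {wb : Fin n → Fin n → ℝ}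
    (hwb : ∀ u v, 0 ≤ wb u v) (hself : ∀ v, wb v v = 0) (l : List (Fin n))
    (hl : l.Pairwise fun u v => π v < π u) (st : Alloc n k × Finset (Fin n)) {v : Fin n}
    (hv : v ∈ l) (hrem : v ∈ (l.foldl (roundStep wb) st).2) :
    1 ≤ conflict wb (fun u => π u < π v) st.1 (st.1 v) v +
      conflict wb (fun u => π v < π u) (l.foldl (roundStep wb) st).1 (st.1 v) v := by
  induction l generalizing st with
  | nil => exact absurd hv List.not_mem_nil
  | cons w l ih =>
    rw [List.pairwise_cons] at hl
    rw [List.foldl_cons] at hrem ⊢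
    rcases eq_or_ne v w with rfl | hvw
    · have hvl : v ∉ l := fun h => lt_irrefl _ (hl.1 v h)
      rw [(foldl_roundStep_of_notMem wb l (roundStep wb st v) hvl).2] at hrem
      have hlater : conflict wb (fun u => π v < π u)
          (l.foldl (roundStep wb) (roundStep wb st v)).1 (st.1 v) v =
          conflict wb (fun u => π v < π u) st.1 (st.1 v) v := by
        refine Finset.sum_congr (Finset.filter_congr fun u _ => and_congr_right fun hu => ?_)
          fun _ _ => rfl
        have hul : u ∉ l := fun h => (hl.1 u h).not_gt hu
        have huv : u ≠ v := fun h => by rw [h] at hu; exact lt_irrefl _ hu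
        rw [(foldl_roundStep_of_notMem wb l _ hul).1, roundStep_fst_of_ne wb st huv]
      rw [hlater]
      unfold roundStep at hrem
      split_ifs at hrem with hc
      · exact absurd hrem (Finset.notMem_erase _ _)
      refine (not_lt.mp hc).trans (le_of_eq ?_)
      simp only [conflict, Finset.sum_filter]
      rw [← Finset.sum_add_distrib]
      refine Finset.sum_congr rfl fun u _ => ?_
      rcases lt_trichotomy (π u) (π v) with h | h | h
      · simp [h, h.not_gt]
      · simp [π.injective h, hself]
      · simp [h, h.not_gt]
    · have h := ih hl.2 (roundStep wb st w) ((List.mem_cons.mp hv).resolve_left hvw) hrem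
      rw [roundStep_fst_of_ne wb st hvw] at h
      exact h.trans (add_le_add
        (conflict_mono hwb _ fun u _ => roundStep_fst_subset wb st w u) le_rfl)

/-- The links of `V'` in the order in which a round considers them. -/
def roundOrder (π : Fin n ≃ Fin n) (V' : Finset (Fin n)) : List (Fin n) :=
  ((List.finRange n).reverse.map π.symm).filter fun v => v ∈ V'

theorem roundOrder_pairwise (π : Fin n ≃ Fin n) (V' : Finset (Fin n)) :
    (roundOrder π V').Pairwise fun u v => π v < π u := by
  refine List.Pairwise.filter _ ?_
  rw [List.map_reverse, List.pairwise_reverse]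
  exact pairwise_map_symm_finRange π

theorem roundOrder_nodup (π : Fin n ≃ Fin n) (V' : Finset (Fin n)) : (roundOrder π V').Nodup :=
  (roundOrder_pairwise π V').imp fun h he => by rw [he] at h; exact lt_irrefl _ h

theorem mem_roundOrder (π : Fin n ≃ Fin n) (V' : Finset (Fin n)) (v : Fin n) :
    v ∈ roundOrder π V' ↔ v ∈ V' := by
  simp only [roundOrder, List.mem_filter, List.map_reverse, List.mem_reverse, decide_eq_true_eq]
  exact and_iff_right (mem_map_symm_finRange π v)

theorem resolveRound_eq_foldl (π : Fin n ≃ Fin n) (wb : Fin n → Fin n → ℝ) (S : Alloc n k)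
    (V' : Finset (Fin n)) : resolveRound π wb S V' =
      (roundOrder π V').foldl (roundStep wb) ((fun v => if v ∈ V' then S v else ∅), V') := rfl

theorem resolveRound_conflict_lt (π : Fin n ≃ Fin n) {wb : Fin n → Fin n → ℝ}
    (hwb : ∀ u v, 0 ≤ wb u v) (S : Alloc n k) (V' : Finset (Fin n)) (v : Fin n) :
    conflict wb (fun _ => True) (resolveRound π wb S V').1 ((resolveRound π wb S V').1 v) v < 1 := by
  rw [resolveRound_eq_foldl]
  by_cases hv : v ∈ V'
  · exact foldl_roundStep_sum_lt hwb _ (roundOrder_nodup π V') _ ((mem_roundOrder π V' v).mpr hv)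
  · rw [(foldl_roundStep_of_notMem wb _ _ (mt (mem_roundOrder π V' v).mp hv)).1]
    simp only [hv, if_false, conflict_empty, zero_lt_one]

theorem resolveRound_snd_subset (π : Fin n ≃ Fin n) (wb : Fin n → Fin n → ℝ) (S : Alloc n k)
    (V' : Finset (Fin n)) : (resolveRound π wb S V').2 ⊆ V' := by
  intro v hv
  by_contra hv'
  rw [resolveRound_eq_foldl,
    (foldl_roundStep_of_notMem wb _ _ (mt (mem_roundOrder π V' v).mp hv')).2] at hv
  exact hv' hv

theorem resolveRound_fst_of_mem (π : Fin n ≃ Fin n) (wb : Fin n → Fin n → ℝ) (S : Alloc n k)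
    {V' : Finset (Fin n)} {v : Fin n} (hv : v ∈ V') :
    ((resolveRound π wb S V').1 v = S v ∧ v ∉ (resolveRound π wb S V').2) ∨
      ((resolveRound π wb S V').1 v = ∅ ∧ v ∈ (resolveRound π wb S V').2) := by
  have h := foldl_roundStep_of_mem wb _ (roundOrder_nodup π V')
    ((fun v => if v ∈ V' then S v else ∅), V') ((mem_roundOrder π V' v).mpr hv) hv
  rw [← resolveRound_eq_foldl] at h
  simpa only [if_pos hv] using h

/-- On a partly feasible allocation, a round handles at least half of the links. -/
theorem two_mul_card_resolveRound_le (π : Fin n ≃ Fin n) {wb : Fin n → Fin n → ℝ}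
    (hwb : ∀ u v, 0 ≤ wb u v) (hself : ∀ v, wb v v = 0) (hsymm : ∀ u v, wb u v = wb v u)
    {S : Alloc n k} (hS : PartlyFeasible π wb S) (V' : Finset (Fin n)) :
    2 * (resolveRound π wb S V').2.card ≤ V'.card := by
  set A := (resolveRound π wb S V').1 with hA
  set W := (resolveRound π wb S V').2 with hW
  have hWV : W ⊆ V' := resolveRound_snd_subset π wb S V'
  have hinit : ∀ u, (if u ∈ V' then S u else ∅) ⊆ S u := fun u => by
    split_ifs
    · exact subset_rfl
    · exact Finset.empty_subset _
  -- The failed test gives total weight at least 1, of which partial feasibility leaves less than `1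
  -- / 2` to earlier links. The rest is weight to later links, all kept in this round.
  have hremoved : ∀ v ∈ W, 1 / 2 ≤ conflict wb (fun u => π v < π u) A (S v) v := by
    intro v hv
    have h := foldl_roundStep_removed π hwb hself _ (roundOrder_pairwise π V')
      ((fun v => if v ∈ V' then S v else ∅), V') ((mem_roundOrder π V' v).mpr (hWV hv))
      (by rw [← resolveRound_eq_foldl]; exact hv)
    rw [← resolveRound_eq_foldl, ← hA] at h
    simp only [if_pos (hWV hv)] at h
    have h₁ := (conflict_mono hwb (fun u => π u < π v) (T := S v) (v := v)
      fun u _ => hinit u).trans_lt (hS v)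
    linarith
  have hkept : ∀ v u, (S v ∩ A u).Nonempty → u ∈ V' \ W ∧ A u = S u := by
    intro v u h
    have hu : u ∈ V' := by
      by_contra hu
      have h₁ := (foldl_roundStep_of_notMem wb _ ((fun v => if v ∈ V' then S v else ∅), V')
        (mt (mem_roundOrder π V' u).mp hu)).1
      rw [← resolveRound_eq_foldl, ← hA] at h₁
      simp only [if_neg hu] at h₁
      rw [h₁, Finset.inter_empty] at h
      exact Finset.not_nonempty_empty h
    rcases resolveRound_fst_of_mem π wb S hu with ⟨h₁, h₂⟩ | ⟨h₁, -⟩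
    · exact ⟨Finset.mem_sdiff.mpr ⟨hu, h₂⟩, h₁⟩
    · rw [hA, h₁, Finset.inter_empty] at h
      exact absurd h Finset.not_nonempty_empty
  -- Double counting of weights between removed links and later kept links: at least `1 / 2` per
  -- removed link, at most `1 / 2` per kept one, the latter by partial feasibility again.
  have hle : (W.card : ℝ) * (1 / 2) ≤ (V' \ W).card * (1 / 2) := by
    calc (W.card : ℝ) * (1 / 2) ≤ ∑ v ∈ W, conflict wb (fun u => π v < π u) A (S v) v := by
          rw [← nsmul_eq_mul]
          exact Finset.card_nsmul_le_sum _ _ _ hremoved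
      _ ≤ ∑ v ∈ W, ∑ u ∈ (V' \ W).filter (fun u => π v < π u ∧ (S u ∩ S v).Nonempty), wb v u := by
          refine Finset.sum_le_sum fun v _ => ?_
          refine (Finset.sum_congr rfl fun u _ => hsymm u v).trans_le ?_
          refine Finset.sum_le_sum_of_subset_of_nonneg (fun u hu => ?_) fun u _ _ => hwb v u
          simp only [Finset.mem_filter, Finset.mem_univ, true_and] at hu ⊢
          obtain ⟨h₁, h₂⟩ := hkept v u hu.2
          rw [h₂, Finset.inter_comm] at hu
          exact ⟨h₁, hu⟩
      _ ≤ ∑ v, ∑ u ∈ (V' \ W).filter (fun u => π v < π u ∧ (S u ∩ S v).Nonempty), wb v u :=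
          Finset.sum_le_sum_of_subset_of_nonneg (Finset.subset_univ _) fun v _ _ =>
            Finset.sum_nonneg fun u _ => hwb v u
      _ = ∑ u ∈ V' \ W, conflict wb (fun v => π v < π u) S (S u) u :=
          Finset.sum_comm' fun v u => by
            simp only [Finset.mem_filter, Finset.mem_univ, true_and]; tauto
      _ ≤ _ := by
          rw [← nsmul_eq_mul]
          exact Finset.sum_le_card_nsmul _ _ _ fun u _ => (hS u).le
  have hle' : W.card ≤ (V' \ W).card := by
    have : (W.card : ℝ) ≤ (V' \ W).card := by linarith
    exact_mod_cast this
  have := Finset.card_sdiff_add_card_eq_card hWV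
  omega

/-! ### The sequence of rounds and the best candidate -/

theorem conflict_lt_of_mem_candidates (π : Fin n ≃ Fin n) {wb : Fin n → Fin n → ℝ}
    (hwb : ∀ u v, 0 ≤ wb u v) (S : Alloc n k) (m : ℕ) (V' : Finset (Fin n)) {A : Alloc n k}
    (hA : A ∈ candidates π wb S m V') (v : Fin n) :
    conflict wb (fun _ => True) A (A v) v < 1 := by
  induction m generalizing V' with
  | zero => exact absurd hA List.not_mem_nil
  | succ m ih =>
    unfold candidates at hA
    split_ifs at hA with h
    · exact absurd hA List.not_mem_nil
    · rcases List.mem_cons.mp hA with rfl | hA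
      · exact resolveRound_conflict_lt π hwb S V' v
      · exact ih _ hA

/-- Each round halves `V'`, so `j` rounds exhaust fewer than `2 ^ j` links. Every link keeps its
bundle in the round that deletes it, so the value of `S` on `V'` is spread over at most `j`
candidates. -/
theorem sum_le_of_forall_candidates (π : Fin n ≃ Fin n) {wb : Fin n → Fin n → ℝ}
    (hwb : ∀ u v, 0 ≤ wb u v) (hself : ∀ v, wb v v = 0) (hsymm : ∀ u v, wb u v = wb v u)
    (b : Fin n → Finset (Fin k) → ℕ) {S : Alloc n k} (hS : PartlyFeasible π wb S) {B : ℕ}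
    (m : ℕ) (V' : Finset (Fin n)) (hB : ∀ A ∈ candidates π wb S m V', welfare b A ≤ B)
    (j : ℕ) (hj : V'.card < 2 ^ j) (hjm : j ≤ m) : ∑ v ∈ V', b v (S v) ≤ j * B := by
  induction m generalizing V' j with
  | zero =>
    obtain rfl : j = 0 := by omega
    have : V' = ∅ := Finset.card_eq_zero.mp (by simpa using hj)
    simp [this]
  | succ m ih =>
    by_cases hV : V' = ∅
    · simp [hV]
    unfold candidates at hB
    rw [if_neg hV] at hB
    obtain ⟨i, rfl⟩ : ∃ i, j = i + 1 := by
      refine Nat.exists_eq_succ_of_ne_zero fun h => hV ?_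
      rw [h, pow_zero, Nat.lt_one_iff, Finset.card_eq_zero] at hj
      exact hj
    have hhalf := two_mul_card_resolveRound_le π hwb hself hsymm hS V'
    have hrest := ih (resolveRound π wb S V').2
      (fun A hA => hB A (List.mem_cons_of_mem _ hA)) i (by rw [pow_succ] at hj; omega) (by omega)
    have hfirst := hB _ List.mem_cons_self
    rw [← Finset.sum_sdiff (resolveRound_snd_subset π wb S V'), add_mul, one_mul, add_comm]
    refine add_le_add hrest (le_trans ?_ hfirst)
    calc _ = ∑ v ∈ V' \ (resolveRound π wb S V').2, b v ((resolveRound π wb S V').1 v) := by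
          refine Finset.sum_congr rfl fun v hv => ?_
          rw [Finset.mem_sdiff] at hv
          rcases resolveRound_fst_of_mem π wb S hv.1 with ⟨h, -⟩ | ⟨-, h⟩
          · rw [h]
          · exact absurd h hv.2
      _ ≤ _ := Finset.sum_le_sum_of_subset (Finset.subset_univ _)

/-- With at least one link the first round is run, so the default value is never taken. -/
theorem makeFeasible_mem_argmax (hn : 1 ≤ n) (π : Fin n ≃ Fin n) (wb : Fin n → Fin n → ℝ)
    (b : Fin n → Finset (Fin k) → ℕ) (S : Alloc n k) :
    makeFeasible π wb b S ∈ (candidates π wb S n Finset.univ).argmax (welfare b) := by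
  unfold makeFeasible
  cases h : (candidates π wb S n Finset.univ).argmax (welfare b) with
  | some A => rfl
  | none =>
    rw [List.argmax_eq_none] at h
    obtain ⟨m, rfl⟩ := Nat.exists_eq_succ_of_ne_zero (by omega : n ≠ 0)
    unfold candidates at h
    rw [if_neg (Finset.univ_nonempty.ne_empty)] at h
    exact absurd h (List.cons_ne_nil _ _)

theorem makeFeasible_conflict_lt (hn : 1 ≤ n) (π : Fin n ≃ Fin n) {wb : Fin n → Fin n → ℝ}
    (hwb : ∀ u v, 0 ≤ wb u v) (b : Fin n → Finset (Fin k) → ℕ) (S : Alloc n k) (v : Fin n) :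
    conflict wb (fun _ => True) (makeFeasible π wb b S) (makeFeasible π wb b S v) v < 1 :=
  conflict_lt_of_mem_candidates π hwb S n Finset.univ
    (List.argmax_mem (makeFeasible_mem_argmax hn π wb b S)) v

theorem welfare_le_makeFeasible (hn : 1 ≤ n) (π : Fin n ≃ Fin n) {wb : Fin n → Fin n → ℝ}
    (hwb : ∀ u v, 0 ≤ wb u v) (hself : ∀ v, wb v v = 0) (hsymm : ∀ u v, wb u v = wb v u)
    (b : Fin n → Finset (Fin k) → ℕ) {S : Alloc n k} (hS : PartlyFeasible π wb S) :
    welfare b S ≤ (Nat.log 2 n + 1) * welfare b (makeFeasible π wb b S) := by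
  refine sum_le_of_forall_candidates π hwb hself hsymm b hS n Finset.univ
    (fun A hA => List.le_of_mem_argmax hA (makeFeasible_mem_argmax hn π wb b S)) _ ?_ ?_
  · rw [Finset.card_fin]
    exact Nat.lt_pow_succ_log_self one_lt_two n
  · exact Nat.log_lt_self 2 (by omega)

/-- On every channel of the returned allocation, all weights sum up to less than `1`. -/
theorem sum_channelSet_output_lt (hn : 1 ≤ n) (π : Fin n ≃ Fin n) {wb : Fin n → Fin n → ℝ}
    (hwb : ∀ u v, 0 ≤ wb u v) (b : Fin n → Finset (Fin k) → ℕ) (S₁ S₂ : Alloc n k) (j : Fin k)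
    {v : Fin n} (hv : v ∈ channelSet (output π wb b S₁ S₂) j) :
    ∑ u ∈ channelSet (output π wb b S₁ S₂) j, wb u v < 1 := by
  refine lt_of_le_of_lt ?_ (makeFeasible_conflict_lt hn π hwb b
    (better b (partialResolve π wb S₁) (partialResolve π wb S₂)) v)
  refine Finset.sum_le_sum_of_subset_of_nonneg (fun u hu => ?_) fun u _ _ => hwb u v
  simp only [channelSet, Finset.mem_filter, Finset.mem_univ, true_and] at hu hv ⊢
  exact ⟨j, Finset.mem_inter.mpr ⟨hv, hu⟩⟩

/-- The returned allocation loses a logarithmic factor compared with either rounding stage. -/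
theorem welfare_partialResolve_le_output (hn : 1 ≤ n) (π : Fin n ≃ Fin n)
    {wb : Fin n → Fin n → ℝ} (hwb : ∀ u v, 0 ≤ wb u v) (hself : ∀ v, wb v v = 0)
    (hsymm : ∀ u v, wb u v = wb v u) (b : Fin n → Finset (Fin k) → ℕ) (S₁ S₂ : Alloc n k) :
    welfare b (partialResolve π wb S₁) ≤ (Nat.log 2 n + 1) * welfare b (output π wb b S₁ S₂) ∧
    welfare b (partialResolve π wb S₂) ≤ (Nat.log 2 n + 1) * welfare b (output π wb b S₁ S₂) := by
  have hpf : PartlyFeasible π wb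
      (better b (partialResolve π wb S₁) (partialResolve π wb S₂)) := by
    unfold better
    split_ifs
    · exact partlyFeasible_partialResolve π wb S₁
    · exact partlyFeasible_partialResolve π wb S₂
  have h := welfare_le_makeFeasible hn π hwb hself hsymm b hpf
  have hb : welfare b (partialResolve π wb S₁) ≤
      welfare b (better b (partialResolve π wb S₁) (partialResolve π wb S₂)) ∧
      welfare b (partialResolve π wb S₂) ≤
      welfare b (better b (partialResolve π wb S₁) (partialResolve π wb S₂)) := by
    unfold better
    split_ifs with hc
    · exact ⟨le_rfl, hc⟩
    · exact ⟨(not_le.mp hc).le, le_rfl⟩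
  exact ⟨hb.1.trans h, hb.2.trans h⟩

end SpectrumAuction

namespace SpectrumAuction

/-! ### Independent choices -/

theorem sum_prod_eq_prod_sum {ι Ω : Type*} [Fintype ι] [DecidableEq ι] [Fintype Ω]
    (g : ι → Ω → ℝ) : ∑ S : ι → Ω, ∏ v, g v (S v) = ∏ v, ∑ T, g v T := by
  rw [Finset.prod_univ_sum, Fintype.piFinset_univ]

section Independent

variable {ι Ω : Type*} [Fintype ι] [DecidableEq ι] [Fintype Ω] {q : ι → Ω → ℝ}

theorem sum_prod_eq_one (hq : ∀ v, ∑ T, q v T = 1) : ∑ S : ι → Ω, ∏ v, q v (S v) = 1 := by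
  rw [sum_prod_eq_prod_sum]
  exact Finset.prod_eq_one fun v _ => hq v

theorem sum_prod_mul_apply (hq : ∀ v, ∑ T, q v T = 1) (v : ι) (f : Ω → ℝ) :
    ∑ S : ι → Ω, (∏ w, q w (S w)) * f (S v) = ∑ T, q v T * f T := by
  -- A function of one coordinate is a product over all coordinates whose other factors are 1.
  have h := sum_prod_eq_prod_sum fun w T => q w T * if w = v then f T else 1
  simp only [Finset.prod_mul_distrib, Finset.prod_ite_eq', Finset.mem_univ, if_true] at h
  rw [h, Fintype.prod_eq_single v fun w hw => by simp [hw, hq]]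
  simp

theorem sum_prod_mul_mul (hq : ∀ v, ∑ T, q v T = 1) {u v : ι} (huv : v ≠ u) (f g : Ω → ℝ) :
    ∑ S : ι → Ω, (∏ w, q w (S w)) * (f (S v) * g (S u)) =
      (∑ T, q v T * f T) * ∑ T, q u T * g T := by
  have h := sum_prod_eq_prod_sum fun w T =>
    q w T * ((if w = v then f T else 1) * if w = u then g T else 1)
  simp only [Finset.prod_mul_distrib, Finset.prod_ite_eq', Finset.mem_univ, if_true] at h
  rw [h, Fintype.prod_eq_mul v u huv fun w hw => by simp [hw.1, hw.2, hq]]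
  simp [huv, huv.symm]

theorem sum_prod_mul_apply₂ [DecidableEq Ω] (hq : ∀ v, ∑ T, q v T = 1) {u v : ι} (huv : v ≠ u)
    (F : Ω → Ω → ℝ) : ∑ S : ι → Ω, (∏ w, q w (S w)) * F (S v) (S u) =
      ∑ T, q v T * ∑ T', q u T' * F T T' := by
  -- Splitting by the value at `v` turns `F` into a sum of products of one-coordinate functions.
  have hF : ∀ S : ι → Ω, F (S v) (S u) =
      ∑ T, (if S v = T then 1 else 0) * F T (S u) := fun S => by simp
  simp only [hF]
  rw [Finset.sum_congr rfl fun S _ => Finset.mul_sum _ _ _, Finset.sum_comm]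
  refine Finset.sum_congr rfl fun T _ => ?_
  rw [sum_prod_mul_mul hq huv (fun T' => if T' = T then 1 else 0) (F T)]
  simp

end Independent

variable {n k : ℕ}

/-- A rounding stage with few expected conflicts retains half of the welfare in expectation. -/
theorem half_sum_le_expected_partialResolve (π : Fin n ≃ Fin n) {wb : Fin n → Fin n → ℝ}
    (hwb : ∀ u v, 0 ≤ wb u v) (b : Fin n → Finset (Fin k) → ℕ)
    {q : Fin n → Finset (Fin k) → ℝ} (hq₀ : ∀ v T, 0 ≤ q v T) (hq₁ : ∀ v, ∑ T, q v T = 1)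
    (hconf : ∀ v T, q v T ≠ 0 → ∑ u ∈ Finset.univ.filter (fun u => π u < π v),
      wb u v * ∑ T', q u T' * (if (T ∩ T').Nonempty then 1 else 0) ≤ 1 / 4) :
    1 / 2 * ∑ v, ∑ T, q v T * b v T ≤
      ∑ S : Alloc n k, (∏ v, q v (S v)) * (welfare b (partialResolve π wb S) : ℝ) := by
  -- Markov's inequality in pointwise form: `b (1 - 2 * conflict)` is at most `b` if `v` survives
  -- and at most 0 if the conflict reaches `1 / 2`. The expected conflict of `1 / 4` then leaves the
  -- factor `1 / 2`.
  have hpoint : ∀ (S : Alloc n k) (v : Fin n),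
      (b v (S v) : ℝ) - 2 * ∑ u ∈ Finset.univ.filter (fun u => π u < π v),
        wb u v * (b v (S v) * if (S v ∩ S u).Nonempty then 1 else 0) ≤
      b v (partialResolve π wb S v) := by
    intro S v
    have hc : ∑ u ∈ Finset.univ.filter (fun u => π u < π v),
        wb u v * (b v (S v) * if (S v ∩ S u).Nonempty then 1 else 0) =
        b v (S v) * conflict wb (fun u => π u < π v) S (S v) v := by
      rw [conflict, ← Finset.filter_filter, Finset.sum_filter (fun u => (S v ∩ S u).Nonempty),
        Finset.mul_sum]
      refine Finset.sum_congr rfl fun u _ => ?_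
      split_ifs <;> ring
    rw [hc]
    have hb : (0 : ℝ) ≤ b v (S v) := Nat.cast_nonneg _
    by_cases h : conflict wb (fun u => π u < π v) S (S v) v < 1 / 2
    · rw [partialResolve_eq_self π hwb S h]
      have h₀ : 0 ≤ conflict wb (fun u => π u < π v) S (S v) v :=
        Finset.sum_nonneg fun u _ => hwb u v
      have := mul_nonneg hb h₀
      linarith
    · have h₁ := mul_le_mul_of_nonneg_left (not_lt.mp h) hb
      have h₂ : (0 : ℝ) ≤ b v (partialResolve π wb S v) := Nat.cast_nonneg _
      linarith
  calc 1 / 2 * ∑ v, ∑ T, q v T * b v T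
      ≤ ∑ v, (∑ T, q v T * b v T - 2 * ∑ u ∈ Finset.univ.filter (fun u => π u < π v),
          wb u v * ∑ T, q v T * ∑ T', q u T' *
            (b v T * if (T ∩ T').Nonempty then 1 else 0)) := by
        rw [Finset.mul_sum]
        refine Finset.sum_le_sum fun v _ => ?_
        have hswap : ∑ u ∈ Finset.univ.filter (fun u => π u < π v),
            wb u v * ∑ T, q v T * ∑ T', q u T' *
              (b v T * if (T ∩ T').Nonempty then 1 else 0) =
            ∑ T, q v T * b v T * ∑ u ∈ Finset.univ.filter (fun u => π u < π v),
              wb u v * ∑ T', q u T' * (if (T ∩ T').Nonempty then 1 else 0) := by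
          simp only [Finset.mul_sum]
          rw [Finset.sum_comm]
          refine Finset.sum_congr rfl fun T _ => Finset.sum_congr rfl fun u _ =>
            Finset.sum_congr rfl fun T' _ => ?_
          ring
        rw [hswap, Finset.mul_sum, Finset.mul_sum, ← Finset.sum_sub_distrib]
        refine Finset.sum_le_sum fun T _ => ?_
        by_cases hT : q v T = 0
        · simp [hT]
        have h₁ : 0 ≤ q v T * b v T := mul_nonneg (hq₀ v T) (Nat.cast_nonneg _)
        have := mul_le_mul_of_nonneg_left (hconf v T hT) h₁
        linarith
    _ = ∑ v, ∑ S : Alloc n k, (∏ w, q w (S w)) *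
          (b v (S v) - 2 * ∑ u ∈ Finset.univ.filter (fun u => π u < π v),
            wb u v * (b v (S v) * if (S v ∩ S u).Nonempty then 1 else 0)) := by
        refine Finset.sum_congr rfl fun v _ => ?_
        simp only [mul_sub, Finset.sum_sub_distrib]
        rw [sum_prod_mul_apply hq₁ v fun T => (b v T : ℝ)]
        congr 1
        simp only [Finset.mul_sum (s := Finset.univ.filter fun u => π u < π v)]
        rw [Finset.sum_comm]
        refine Finset.sum_congr rfl fun u hu => ?_
        have huv : v ≠ u := fun h => by
          rw [h] at hu
          exact lt_irrefl _ (Finset.mem_filter.mp hu).2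
        rw [← sum_prod_mul_apply₂ hq₁ huv fun T T' =>
          (b v T : ℝ) * if (T ∩ T').Nonempty then 1 else 0, Finset.mul_sum, Finset.mul_sum]
        exact Finset.sum_congr rfl fun S _ => by ring
    _ ≤ ∑ v, ∑ S : Alloc n k, (∏ w, q w (S w)) * (b v (partialResolve π wb S v) : ℝ) :=
        Finset.sum_le_sum fun v _ => Finset.sum_le_sum fun S _ =>
          mul_le_mul_of_nonneg_left (hpoint S v) (Finset.prod_nonneg fun w _ => hq₀ w _)
    _ = _ := by
        rw [Finset.sum_comm]
        refine Finset.sum_congr rfl fun S _ => ?_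
        rw [welfare, Nat.cast_sum, Finset.mul_sum]

/-! ### Rounding an LP solution -/

section Rounding

variable {ρ : ℝ} {y : Fin n → Finset (Fin k) → ℝ}

theorem sum_roundProb (ρ : ℝ) (y : Fin n → Finset (Fin k) → ℝ) (v : Fin n) :
    ∑ T, roundProb ρ y v T = 1 := by
  have h : ∑ T ∈ Finset.univ.erase ∅, roundProb ρ y v T =
      ∑ T ∈ Finset.univ.erase ∅, y v T / (4 * Real.sqrt k * ρ) :=
    Finset.sum_congr rfl fun T hT => if_neg (Finset.ne_of_mem_erase hT)
  rw [← Finset.add_sum_erase _ _ (Finset.mem_univ ∅), h, roundProb, if_pos rfl, sub_add_cancel]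

/-- Only an inequality for the empty bundle, which receives all leftover probability. It is still
needed there, because the empty bundle may have positive value. -/
theorem div_le_roundProb (hρ : 1 ≤ 4 * Real.sqrt k * ρ) (hy : ∀ v, ∑ T, y v T ≤ 1) (v : Fin n)
    (T : Finset (Fin k)) : y v T / (4 * Real.sqrt k * ρ) ≤ roundProb ρ y v T := by
  unfold roundProb
  split_ifs with hT
  · rw [hT, le_sub_iff_add_le, Finset.add_sum_erase _ (fun T => y v T / (4 * Real.sqrt k * ρ))
      (Finset.mem_univ ∅), ← Finset.sum_div, div_le_one (by linarith)]
    exact (hy v).trans hρ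
  · exact le_rfl

theorem roundProb_nonneg (hρ : 1 ≤ 4 * Real.sqrt k * ρ) (hy₀ : ∀ v T, 0 ≤ y v T)
    (hy : ∀ v, ∑ T, y v T ≤ 1) (v : Fin n) (T : Finset (Fin k)) : 0 ≤ roundProb ρ y v T :=
  (div_nonneg (hy₀ v T) (by linarith)).trans (div_le_roundProb hρ hy v T)

/-- Expected conflicts are bounded by the LP constraints, if intersections with `T` are dominated
by a combination of channels of total weight at most `√k`. -/
theorem expected_conflict_le (hk : 1 ≤ k) (hρ : 0 < ρ) {π : Fin n ≃ Fin n}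
    {wb : Fin n → Fin n → ℝ} (hwb : ∀ u v, 0 ≤ wb u v) {v : Fin n}
    (hLP : ∀ j, ∑ u ∈ Finset.univ.filter (fun u => π u < π v),
      ∑ T ∈ Finset.univ.filter (fun T : Finset (Fin k) => j ∈ T), wb u v * y u T ≤ ρ)
    (T : Finset (Fin k)) (a : Fin k → ℝ) (ha₀ : ∀ j, 0 ≤ a j) (ha : ∑ j, a j ≤ Real.sqrt k)
    (hT : ∀ u T', y u T' * (if (T ∩ T').Nonempty then 1 else 0) ≤
      ∑ j, a j * if j ∈ T' then y u T' else 0) :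
    ∑ u ∈ Finset.univ.filter (fun u => π u < π v),
      wb u v * ∑ T', roundProb ρ y u T' * (if (T ∩ T').Nonempty then 1 else 0) ≤ 1 / 4 := by
  have hk0 : (0 : ℝ) < Real.sqrt k := Real.sqrt_pos.mpr (by exact_mod_cast hk)
  set c := 4 * Real.sqrt k * ρ with hc
  have hc0 : 0 < c := by positivity
  -- The exceptional probability of the empty bundle is harmless, since that bundle meets no other.
  have hround : ∀ u T', roundProb ρ y u T' * (if (T ∩ T').Nonempty then (1 : ℝ) else 0) =
      y u T' * (if (T ∩ T').Nonempty then 1 else 0) / c := by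
    intro u T'
    rcases eq_or_ne T' ∅ with rfl | hT'
    · simp
    · rw [roundProb, if_neg hT', div_mul_eq_mul_div]
  calc _ ≤ ∑ u ∈ Finset.univ.filter (fun u => π u < π v), wb u v * ∑ T',
        (∑ j, a j * if j ∈ T' then y u T' else 0) / c := by
        refine Finset.sum_le_sum fun u _ => mul_le_mul_of_nonneg_left
          (Finset.sum_le_sum fun T' _ => ?_) (hwb u v)
        rw [hround]
        exact div_le_div_of_nonneg_right (hT u T') hc0.le
    _ = (∑ j, a j * ∑ u ∈ Finset.univ.filter (fun u => π u < π v),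
          ∑ T ∈ Finset.univ.filter (fun T : Finset (Fin k) => j ∈ T), wb u v * y u T) / c := by
        simp only [← Finset.sum_div, ← mul_div_assoc, Finset.sum_filter (fun T => _ ∈ T)]
        congr 1
        simp only [Finset.mul_sum]
        rw [Finset.sum_comm' (t' := Finset.univ)
          (s' := fun _ => Finset.univ.filter fun u => π u < π v) (by simp)]
        rw [Finset.sum_comm' (t' := Finset.univ.filter fun u => π u < π v)
          (s' := fun _ => Finset.univ) (by simp)]
        rw [Finset.sum_comm' (s := Finset.univ) (t' := Finset.univ.filter fun u => π u < π v)
          (s' := fun _ => Finset.univ) (by simp)]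
        refine Finset.sum_congr rfl fun u _ => ?_
        rw [Finset.sum_comm]
        refine Finset.sum_congr rfl fun j _ => Finset.sum_congr rfl fun T _ => ?_
        split_ifs <;> ring
    _ ≤ (∑ j, a j * ρ) / c := by
        refine div_le_div_of_nonneg_right (Finset.sum_le_sum fun j _ =>
          mul_le_mul_of_nonneg_left (hLP j) (ha₀ j)) hc0.le
    _ ≤ Real.sqrt k * ρ / c := by
        rw [← Finset.sum_mul]
        exact div_le_div_of_nonneg_right (mul_le_mul_of_nonneg_right ha hρ.le) hc0.le
    _ = 1 / 4 := by
        rw [hc]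
        field_simp

/-- A rounding stage obtains a `1 / (8 √k ρ)` fraction of the LP value in expectation. -/
theorem lpValue_le_expected_partialResolve (hρ : 1 ≤ 4 * Real.sqrt k * ρ) {π : Fin n ≃ Fin n}
    {wb : Fin n → Fin n → ℝ} (hwb : ∀ u v, 0 ≤ wb u v) (b : Fin n → Finset (Fin k) → ℕ)
    (hy₀ : ∀ v T, 0 ≤ y v T) (hy : ∀ v, ∑ T, y v T ≤ 1)
    (hconf : ∀ v T, roundProb ρ y v T ≠ 0 → ∑ u ∈ Finset.univ.filter (fun u => π u < π v),
      wb u v * ∑ T', roundProb ρ y u T' * (if (T ∩ T').Nonempty then 1 else 0) ≤ 1 / 4) :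
    lpValue b y ≤ 8 * Real.sqrt k * ρ *
      ∑ S : Alloc n k, roundingProb ρ y S * (welfare b (partialResolve π wb S) : ℝ) := by
  have h := half_sum_le_expected_partialResolve π hwb b (roundProb_nonneg hρ hy₀ hy)
    (sum_roundProb ρ y) hconf
  have h₁ : lpValue b y ≤ 4 * Real.sqrt k * ρ * ∑ v, ∑ T, roundProb ρ y v T * b v T := by
    rw [lpValue, Finset.mul_sum]
    refine Finset.sum_le_sum fun v _ => ?_
    rw [Finset.mul_sum]
    refine Finset.sum_le_sum fun T _ => ?_
    have h₂ := div_le_roundProb hρ hy v T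
    rw [div_le_iff₀' (by linarith)] at h₂
    calc (b v T : ℝ) * y v T ≤ b v T * (4 * Real.sqrt k * ρ * roundProb ρ y v T) :=
          mul_le_mul_of_nonneg_left h₂ (Nat.cast_nonneg _)
      _ = _ := by ring
  have h₃ := mul_le_mul_of_nonneg_left h (by linarith : 0 ≤ 8 * Real.sqrt k * ρ)
  unfold roundingProb
  linarith

end Rounding

/-! ### The stages for small and large bundles -/

section Stages

variable {π : Fin n ≃ Fin n} {wb : Fin n → Fin n → ℝ} {ρ : ℝ} {x : Fin n → Finset (Fin k) → ℝ}

theorem smallPart_nonneg (hx : ∀ v T, 0 ≤ x v T) (v : Fin n) (T : Finset (Fin k)) :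
    0 ≤ smallPart x v T := by
  unfold smallPart
  split_ifs
  · exact hx v T
  · exact le_rfl

theorem smallPart_le (hx : ∀ v T, 0 ≤ x v T) (v : Fin n) (T : Finset (Fin k)) :
    smallPart x v T ≤ x v T := by
  unfold smallPart
  split_ifs
  · exact le_rfl
  · exact hx v T

theorem largePart_nonneg (hx : ∀ v T, 0 ≤ x v T) (v : Fin n) (T : Finset (Fin k)) :
    0 ≤ largePart x v T := sub_nonneg.mpr (smallPart_le hx v T)

theorem largePart_le (hx : ∀ v T, 0 ≤ x v T) (v : Fin n) (T : Finset (Fin k)) :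
    largePart x v T ≤ x v T := sub_le_self _ (smallPart_nonneg hx v T)

theorem LPFeasible.mono (hwb : ∀ u v, 0 ≤ wb u v) {y : Fin n → Finset (Fin k) → ℝ}
    (hx : LPFeasible π wb ρ x) (hy : ∀ v T, 0 ≤ y v T) (hyx : ∀ v T, y v T ≤ x v T) :
    LPFeasible π wb ρ y :=
  ⟨fun v j => (Finset.sum_le_sum fun u _ => Finset.sum_le_sum fun T _ =>
      mul_le_mul_of_nonneg_left (hyx u T) (hwb u v)).trans (hx.1 v j),
    fun v => (Finset.sum_le_sum fun T _ => hyx v T).trans (hx.2.1 v), hy⟩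

/-- Union bound over the channels of `T`: coefficient 1 on each channel, at most `√k` in total
because every `T` drawn in this stage is small. -/
theorem lpValue_smallPart_le (hk : 1 ≤ k) (hρ₀ : 0 < ρ) (hρ : 1 ≤ 4 * Real.sqrt k * ρ)
    (hwb : ∀ u v, 0 ≤ wb u v) (b : Fin n → Finset (Fin k) → ℕ) (hx : LPFeasible π wb ρ x) :
    lpValue b (smallPart x) ≤ 8 * Real.sqrt k * ρ * ∑ S : Alloc n k,
      roundingProb ρ (smallPart x) S * (welfare b (partialResolve π wb S) : ℝ) := by
  have hs := hx.mono hwb (smallPart_nonneg hx.2.2) (smallPart_le hx.2.2)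
  refine lpValue_le_expected_partialResolve hρ hwb b hs.2.2 hs.2.1 fun v T hT => ?_
  have hcard : (T.card : ℝ) ≤ Real.sqrt k := by
    by_contra hcard
    have hne : T ≠ ∅ := fun h => hcard (by rw [h]; simp)
    exact hT (by rw [roundProb, if_neg hne, smallPart, if_neg hcard, zero_div])
  refine expected_conflict_le hk hρ₀ hwb (hs.1 v) T (fun j => if j ∈ T then 1 else 0)
    (fun j => by split_ifs <;> norm_num) (by simpa using hcard) fun u T' => ?_
  have hterm : ∀ j, 0 ≤ (if j ∈ T then (1 : ℝ) else 0) * if j ∈ T' then smallPart x u T' else 0 :=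
    fun j => mul_nonneg (by split_ifs <;> norm_num)
      (by split_ifs; exacts [hs.2.2 u T', le_rfl])
  split_ifs with hTT
  · obtain ⟨j, hj⟩ := hTT
    rw [Finset.mem_inter] at hj
    refine le_trans (le_of_eq ?_) (Finset.single_le_sum (fun j _ => hterm j) (Finset.mem_univ j))
    rw [if_pos hj.1, if_pos hj.2, mul_comm]
  · rw [mul_zero]
    exact Finset.sum_nonneg fun j _ => hterm j

/-- Here the other bundle `T'` is large: with coefficient `1 / √k` on all `k` channels its more than
`√k` channels already add up to at least 1, whatever `T` is, and the coefficients sum to `√k`. -/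
theorem lpValue_largePart_le (hk : 1 ≤ k) (hρ₀ : 0 < ρ) (hρ : 1 ≤ 4 * Real.sqrt k * ρ)
    (hwb : ∀ u v, 0 ≤ wb u v) (b : Fin n → Finset (Fin k) → ℕ) (hx : LPFeasible π wb ρ x) :
    lpValue b (largePart x) ≤ 8 * Real.sqrt k * ρ * ∑ S : Alloc n k,
      roundingProb ρ (largePart x) S * (welfare b (partialResolve π wb S) : ℝ) := by
  have hs := hx.mono hwb (largePart_nonneg hx.2.2) (largePart_le hx.2.2)
  have hk0 : (0 : ℝ) < Real.sqrt k := Real.sqrt_pos.mpr (by exact_mod_cast hk)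
  refine lpValue_le_expected_partialResolve hρ hwb b hs.2.2 hs.2.1 fun v T _ => ?_
  refine expected_conflict_le hk hρ₀ hwb (hs.1 v) T (fun _ => (Real.sqrt k)⁻¹)
    (fun _ => inv_nonneg.mpr hk0.le) (le_of_eq ?_) fun u T' => ?_
  · rw [Finset.sum_const, Finset.card_fin, nsmul_eq_mul, ← div_eq_mul_inv, Real.div_sqrt]
  rw [← Finset.mul_sum, Finset.sum_ite_mem, Finset.univ_inter, Finset.sum_const, nsmul_eq_mul]
  by_cases hcard : (T'.card : ℝ) ≤ Real.sqrt k
  · have : largePart x u T' = 0 := by rw [largePart, smallPart, if_pos hcard, sub_self]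
    simp [this]
  · have hy := hs.2.2 u T'
    calc _ ≤ largePart x u T' * 1 :=
          mul_le_mul_of_nonneg_left (by split_ifs <;> norm_num) hy
      _ = (Real.sqrt k)⁻¹ * (Real.sqrt k * largePart x u T') := by field_simp
      _ ≤ _ := mul_le_mul_of_nonneg_left
          (mul_le_mul_of_nonneg_right (not_le.mp hcard).le hy) (inv_nonneg.mpr hk0.le)

theorem lpValue_eq_add (b : Fin n → Finset (Fin k) → ℕ) (x : Fin n → Finset (Fin k) → ℝ) :
    lpValue b x = lpValue b (smallPart x) + lpValue b (largePart x) := by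
  simp only [lpValue, ← Finset.sum_add_distrib, ← mul_add, largePart, add_sub_cancel]

/-- The output is compared with each stage separately, so the two bounds with `8 √k ρ` add up to `16
√k ρ`. -/
theorem lpValue_le_expectedWelfare (hn : 1 ≤ n) (hk : 1 ≤ k) (hρ₀ : 0 < ρ)
    (hρ : 1 ≤ 4 * Real.sqrt k * ρ) (hwb : ∀ u v, 0 ≤ wb u v) (hself : ∀ v, wb v v = 0)
    (hsymm : ∀ u v, wb u v = wb v u) (b : Fin n → Finset (Fin k) → ℕ)
    (hx : LPFeasible π wb ρ x) :
    lpValue b x ≤ 16 * Real.sqrt k * ρ * (Nat.log 2 n + 1) * expectedWelfare π wb ρ b x := by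
  have hs := hx.mono hwb (smallPart_nonneg hx.2.2) (smallPart_le hx.2.2)
  have hl := hx.mono hwb (largePart_nonneg hx.2.2) (largePart_le hx.2.2)
  have hp₁ : ∀ S : Alloc n k, 0 ≤ roundingProb ρ (smallPart x) S := fun S =>
    Finset.prod_nonneg fun v _ => roundProb_nonneg hρ hs.2.2 hs.2.1 v _
  have hp₂ : ∀ S : Alloc n k, 0 ≤ roundingProb ρ (largePart x) S := fun S =>
    Finset.prod_nonneg fun v _ => roundProb_nonneg hρ hl.2.2 hl.2.1 v _
  have hone₁ : ∑ S : Alloc n k, roundingProb ρ (smallPart x) S = 1 :=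
    sum_prod_eq_one (sum_roundProb ρ _)
  have hone₂ : ∑ S : Alloc n k, roundingProb ρ (largePart x) S = 1 :=
    sum_prod_eq_one (sum_roundProb ρ _)
  have hout : ∀ S₁ S₂ : Alloc n k,
      (welfare b (partialResolve π wb S₁) : ℝ) ≤
        (Nat.log 2 n + 1) * welfare b (output π wb b S₁ S₂) ∧
      (welfare b (partialResolve π wb S₂) : ℝ) ≤
        (Nat.log 2 n + 1) * welfare b (output π wb b S₁ S₂) := fun S₁ S₂ => by
    have h := welfare_partialResolve_le_output hn π hwb hself hsymm b S₁ S₂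
    exact_mod_cast h
  have h₁ : ∑ S : Alloc n k, roundingProb ρ (smallPart x) S *
      (welfare b (partialResolve π wb S) : ℝ) ≤
      (Nat.log 2 n + 1) * expectedWelfare π wb ρ b x := by
    rw [expectedWelfare, Finset.mul_sum]
    refine Finset.sum_le_sum fun S₁ _ => ?_
    -- Averaging over the other, independent stage changes nothing, as its probabilities sum to 1.
    rw [show roundingProb ρ (smallPart x) S₁ * (welfare b (partialResolve π wb S₁) : ℝ) =
      ∑ S₂, roundingProb ρ (smallPart x) S₁ * roundingProb ρ (largePart x) S₂ *
        (welfare b (partialResolve π wb S₁) : ℝ) by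
          rw [← Finset.sum_mul, ← Finset.mul_sum, hone₂, mul_one], Finset.mul_sum]
    refine Finset.sum_le_sum fun S₂ _ => ?_
    rw [mul_left_comm]
    exact mul_le_mul_of_nonneg_left (hout S₁ S₂).1 (mul_nonneg (hp₁ S₁) (hp₂ S₂))
  have h₂ : ∑ S : Alloc n k, roundingProb ρ (largePart x) S *
      (welfare b (partialResolve π wb S) : ℝ) ≤
      (Nat.log 2 n + 1) * expectedWelfare π wb ρ b x := by
    rw [expectedWelfare, Finset.sum_comm, Finset.mul_sum]
    refine Finset.sum_le_sum fun S₂ _ => ?_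
    rw [show roundingProb ρ (largePart x) S₂ * (welfare b (partialResolve π wb S₂) : ℝ) =
      ∑ S₁, roundingProb ρ (smallPart x) S₁ * roundingProb ρ (largePart x) S₂ *
        (welfare b (partialResolve π wb S₂) : ℝ) by
          rw [← Finset.sum_mul, ← Finset.sum_mul, hone₁, one_mul], Finset.mul_sum]
    refine Finset.sum_le_sum fun S₁ _ => ?_
    rw [mul_left_comm]
    exact mul_le_mul_of_nonneg_left (hout S₁ S₂).2 (mul_nonneg (hp₁ S₁) (hp₂ S₂))
  have hc : 0 ≤ 8 * Real.sqrt k * ρ := by linarith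
  rw [lpValue_eq_add]
  have h₃ := (lpValue_smallPart_le hk hρ₀ hρ hwb b hx).trans (mul_le_mul_of_nonneg_left h₁ hc)
  have h₄ := (lpValue_largePart_le hk hρ₀ hρ hwb b hx).trans (mul_le_mul_of_nonneg_left h₂ hc)
  linarith

end Stages

/-! ### The linear program -/

/-- The feasible region is a closed subset of the unit box and contains 0, and the objective is
continuous. -/
theorem exists_lpOptimal (π : Fin n ≃ Fin n) (wb : Fin n → Fin n → ℝ) {ρ : ℝ} (hρ : 0 ≤ ρ)
    (b : Fin n → Finset (Fin k) → ℕ) : ∃ x, LPOptimal π wb ρ b x := by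
  have hcompact : IsCompact {x : Fin n → Finset (Fin k) → ℝ | LPFeasible π wb ρ x} := by
    refine IsCompact.of_isClosed_subset (isCompact_Icc (a := (0 : Fin n → Finset (Fin k) → ℝ))
      (b := 1)) ?_ fun x hx => ⟨fun v T => hx.2.2 v T, fun v T => ?_⟩
    · simp only [LPFeasible, Set.ofPred_and, Set.ofPred_forall]
      refine (isClosed_iInter fun v => isClosed_iInter fun j => isClosed_le ?_ continuous_const).inter
        ((isClosed_iInter fun v => isClosed_le ?_ continuous_const).inter
          (isClosed_iInter fun v => isClosed_iInter fun T => isClosed_le continuous_const ?_)) <;>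
        fun_prop
    · exact (Finset.single_le_sum (fun T _ => hx.2.2 v T) (Finset.mem_univ T)).trans (hx.2.1 v)
  have hcont : Continuous fun x : Fin n → Finset (Fin k) → ℝ => lpValue b x := by
    unfold lpValue
    fun_prop
  obtain ⟨x, hx, hmax⟩ := hcompact.exists_isMaxOn
    ⟨0, by simpa [LPFeasible] using fun _ _ => hρ⟩ hcont.continuousOn
  exact ⟨x, hx, fun y hy => hmax hy⟩

/-- An allocation is a solution of the LP, if on every channel the weights of the assigned links to
later links are bounded. -/
theorem welfare_le_of_lpOptimal {π : Fin n ≃ Fin n} {wb : Fin n → Fin n → ℝ} {ρ : ℝ}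
    {b : Fin n → Finset (Fin k) → ℕ} {x : Fin n → Finset (Fin k) → ℝ}
    (hx : LPOptimal π wb ρ b x) {S : Alloc n k}
    (hS : ∀ v j, ∑ u ∈ (channelSet S j).filter (fun u => π u < π v), wb u v ≤ ρ) :
    (welfare b S : ℝ) ≤ lpValue b x := by
  -- The competitor is the indicator vector of `S`.
  refine le_of_eq_of_le ?_ (hx.2 (fun v T => if T = S v then 1 else 0) ⟨fun v j => ?_, fun v => ?_,
    fun v T => by dsimp only; split_ifs <;> norm_num⟩)
  · simp [lpValue, welfare]
  · refine le_of_eq_of_le ?_ (hS v j)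
    rw [channelSet, Finset.filter_filter]
    simp only [mul_ite, mul_one, mul_zero, Finset.sum_ite_eq', Finset.mem_filter, Finset.mem_univ,
      true_and]
    rw [← Finset.sum_filter, Finset.filter_filter]
    exact Finset.sum_congr (Finset.filter_congr fun u _ => and_comm) fun _ _ => rfl
  · simp

end SpectrumAuction

/-! ### Assembling the approximation guarantee -/

namespace SpectrumAuction

theorem natLog_two_add_one_le {n : ℕ} (hn : 2 ≤ n) :
    (Nat.log 2 n : ℝ) + 1 ≤ 2 / Real.log 2 * Real.log n := by
  have hlog2 : 0 < Real.log 2 := Real.log_pos (by norm_num)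
  have h₁ : (Nat.log 2 n : ℝ) ≤ Real.log n / Real.log 2 := by
    have h := Real.natLog_le_logb n 2
    rwa [Real.logb, Nat.cast_ofNat] at h
  have h₂ : 1 ≤ Real.log n / Real.log 2 :=
    (one_le_div hlog2).mpr (Real.log_le_log (by norm_num) (by exact_mod_cast hn))
  calc _ ≤ Real.log n / Real.log 2 + Real.log n / Real.log 2 := add_le_add h₁ h₂
    _ = _ := by ring

/-- Geometry enters only through the smallness of `τ` (for power control) and the bound `ρ` on
weights in feasible sets (for the LP). Requiring `ρ ≥ 1` ensures `4 √k ρ ≥ 1`, so that the rounding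
uses probabilities. -/
theorem achieves_of_sum_symmWeight_le {X : Type*} [MetricSpace X] {n k : ℕ} {α β ν τ ρ : ℝ}
    (hα : 0 < α) (hβ : 0 < β) (hτ : 0 < τ) (hτ₁ : τ ≤ 1)
    (hτβ : 8 * β * 3 ^ α * (1 + 2 * β) * τ ≤ 1) (hν : 0 ≤ ν) (hn : 2 ≤ n) (hk : 1 ≤ k)
    (hρ : 1 ≤ ρ) {s r : Fin n → X} (hsr : ∀ v, s v ≠ r v) {π : Fin n ≃ Fin n}
    (hweight : ∀ (M : Finset (Fin n)) (p : Fin n → ℝ) (v : Fin n), SINR α β ν s r M p →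
      (∀ u ∈ M, π u < π v) → ∑ u ∈ M, symmWeight (weight α τ s r π) u v ≤ ρ)
    (b : Fin n → Finset (Fin k) → ℕ) :
    Achieves α β ν τ ρ s r π b (32 * ρ / Real.log 2 * (Real.sqrt k * Real.log n)) := by
  set wb := symmWeight (weight α τ s r π) with hwb_def
  have hwb : ∀ u v, 0 ≤ wb u v := symmWeight_nonneg (weight_nonneg hτ s r π)
  have hself : ∀ v, wb v v = 0 := fun v => by
    rw [hwb_def, symmWeight, weight_self, add_zero]
  have hsymm : ∀ u v, wb u v = wb v u := symmWeight_comm _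
  have hk1 : 1 ≤ Real.sqrt k := Real.one_le_sqrt.mpr (by exact_mod_cast hk)
  have hρ' : 1 ≤ 4 * Real.sqrt k * ρ := by nlinarith
  refine ⟨exists_lpOptimal π wb (by linarith) b, fun x hx => ⟨fun v T => ?_, fun S₁ S₂ j => ?_,
    fun S hS => ?_⟩⟩
  · have hs := hx.1.mono hwb (smallPart_nonneg hx.1.2.2) (smallPart_le hx.1.2.2)
    have hl := hx.1.mono hwb (largePart_nonneg hx.1.2.2) (largePart_le hx.1.2.2)
    exact ⟨roundProb_nonneg hρ' hs.2.2 hs.2.1 v T, roundProb_nonneg hρ' hl.2.2 hl.2.1 v T⟩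
  · exact powerControl_sinr hα hβ hτ hτ₁ hτβ hν hsr π fun v hv =>
      sum_channelSet_output_lt (by omega) π hwb b S₁ S₂ j hv
  · have h₁ : (welfare b S : ℝ) ≤ lpValue b x := by
      refine welfare_le_of_lpOptimal hx fun v j => ?_
      obtain ⟨p, hp⟩ := hS j
      exact hweight _ p v (hp.mono hβ (Finset.filter_subset _ _))
        fun u hu => (Finset.mem_filter.mp hu).2
    have h₂ := lpValue_le_expectedWelfare (by omega) hk (by linarith) hρ' hwb hself hsymm b hx.1
    have hE : 0 ≤ expectedWelfare π wb ρ b x := by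
      have hs := hx.1.mono hwb (smallPart_nonneg hx.1.2.2) (smallPart_le hx.1.2.2)
      have hl := hx.1.mono hwb (largePart_nonneg hx.1.2.2) (largePart_le hx.1.2.2)
      exact Finset.sum_nonneg fun S₁ _ => Finset.sum_nonneg fun S₂ _ => mul_nonneg (mul_nonneg
        (Finset.prod_nonneg fun v _ => roundProb_nonneg hρ' hs.2.2 hs.2.1 v _)
        (Finset.prod_nonneg fun v _ => roundProb_nonneg hρ' hl.2.2 hl.2.1 v _)) (Nat.cast_nonneg _)
    refine h₁.trans (h₂.trans (mul_le_mul_of_nonneg_right ?_ hE))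
    calc 16 * Real.sqrt k * ρ * ((Nat.log 2 n : ℝ) + 1)
        ≤ 16 * Real.sqrt k * ρ * (2 / Real.log 2 * Real.log n) :=
          mul_le_mul_of_nonneg_left (natLog_two_add_one_le hn) (by linarith)
      _ = _ := by ring

end SpectrumAuction

theorem mainTheorem4 (α β : ℝ) (hα : 0 < α) (hβ : 0 < β) :
    ∃ τ : ℝ, 0 < τ ∧
      -- fading metrics
      (∀ C δ : ℝ, δ < α → ∃ ρ K : ℝ, 0 < ρ ∧ 0 < K ∧
        ∀ (X : Type*) [MetricSpace X], SpectrumAuction.HasPacking X C δ →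
        ∀ (n k : ℕ), 2 ≤ n → 1 ≤ k → ∀ (ν : ℝ), 0 ≤ ν →
        ∀ (s r : Fin n → X), (∀ v, s v ≠ r v) →
        ∀ (π : Fin n ≃ Fin n),
          (∀ u v, π u < π v → dist (s v) (r v) ≤ dist (s u) (r u)) →
        ∀ (b : Fin n → Finset (Fin k) → ℕ),
          SpectrumAuction.Achieves α β ν τ ρ s r π b (K * (Real.sqrt k * Real.log n))) ∧
      -- general metrics
      (∃ c K : ℝ, 0 < c ∧ 0 < K ∧
        ∀ (X : Type*) [MetricSpace X],
        ∀ (n k : ℕ), 2 ≤ n → 1 ≤ k → ∀ (ν : ℝ), 0 ≤ ν →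
        ∀ (s r : Fin n → X), (∀ v, s v ≠ r v) →
        ∀ (π : Fin n ≃ Fin n),
          (∀ u v, π u < π v → dist (s v) (r v) ≤ dist (s u) (r u)) →
        ∀ (b : Fin n → Finset (Fin k) → ℕ),
          SpectrumAuction.Achieves α β ν τ (c * Real.log n) s r π b
            (K * (Real.sqrt k * Real.log n ^ 2))) := by
  open SpectrumAuction in
  have hlog2 : 0 < Real.log 2 := Real.log_pos (by norm_num)
  set D : ℝ := 8 * β * 3 ^ α * (1 + 2 * β) with hD
  have hD0 : 0 ≤ D := by positivity
  -- `D` is the constant of `powerControl_sinr`; this choice satisfies both `τ ≤ 1` and `D * τ ≤ 1`.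
  set τ : ℝ := 1 / (1 + D) with hτ_def
  have hτ : 0 < τ := by positivity
  have hτ₁ : τ ≤ 1 := by
    rw [hτ_def, div_le_one (by positivity)]
    linarith
  have hτβ : D * τ ≤ 1 := by
    rw [hτ_def, mul_one_div, div_le_one (by positivity)]
    linarith
  refine ⟨τ, hτ, fun C δ hδ => ?_, ?_⟩
  · set B : ℝ := 2 * (2 ^ α * (C * (1 + 3 ^ α / β) * (1 - 2 ^ (δ - α))⁻¹ + 1)) / τ
    -- The maximum with 1 makes the rounding probabilities valid and keeps `ρ` positive even for a
    -- negative `C`.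
    have hρ : 1 ≤ max 1 B := le_max_left _ _
    refine ⟨max 1 B, 32 * max 1 B / Real.log 2, by positivity, by positivity, ?_⟩
    intro X _ hX n k hn hk ν hν s r hsr π hπ b
    exact achieves_of_sum_symmWeight_le hα hβ hτ hτ₁ hτβ hν hn hk hρ hsr
      (fun M p v hM hMv => (hM.sum_symmWeight_le_of_hasPacking hα hβ hτ hν hδ hX hn hsr hπ
        hMv).trans (le_max_right _ _)) b
  · set B : ℝ := 2 * (2 ^ α * ((1 + 3 ^ α / β) * (1 / (α * Real.log 2) + 1 / Real.log 2) +
      1 / Real.log 2)) / τ with hB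
    have hB0 : 0 ≤ B := by positivity
    -- The summand `1 / log 2` guarantees `ρ = c log n ≥ 1` for all `n ≥ 2`.
    have hc : 0 < B + 1 / Real.log 2 := by positivity
    refine ⟨B + 1 / Real.log 2, 32 * (B + 1 / Real.log 2) / Real.log 2, hc, by positivity, ?_⟩
    intro X _ n k hn hk ν hν s r hsr π hπ b
    have hlogn : Real.log 2 ≤ Real.log n := Real.log_le_log (by norm_num) (by exact_mod_cast hn)
    have hone : 1 ≤ 1 / Real.log 2 * Real.log n := by
      rw [one_div, ← div_eq_inv_mul, one_le_div hlog2]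
      exact hlogn
    have hBn : 0 ≤ B * Real.log n := mul_nonneg hB0 (hlog2.le.trans hlogn)
    have h := achieves_of_sum_symmWeight_le (ρ := (B + 1 / Real.log 2) * Real.log n) hα hβ hτ hτ₁
      hτβ hν hn hk (by linarith) hsr (fun M p v hM hMv => by
        refine (hM.sum_symmWeight_le_log hα hβ hτ hν hn hsr hπ hMv).trans ?_
        have : 2 * (2 ^ α * ((1 + 3 ^ α / β) * (1 / (α * Real.log 2) + 1 / Real.log 2) +
          1 / Real.log 2) * Real.log n) / τ = B * Real.log n := by
            rw [hB]; ring
        rw [this]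
        linarith) b
    convert h using 1
    ring
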